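/- **Conventions.** Algorithms are uniform unless stated otherwise; a probabilistic polynomial-time (PPT) algorithm computes its output in deterministic polynomial time from its input and polynomially many uniform coins. $\mathcal U_m$ is the uniform distribution on $\{0,1\}^m$, $\Delta_s(X;Y)=\frac12\sum_u|\Pr[X=u]-\Pr[Y=u]|$, and $\mathcal L_n=\mathcal L\cap\{0,1\}^n$. A polynomial-time oracle-aided algorithm $R$ is a single probabilistic oracle program whose number of steps on an input $x$ is bounded by a fixed polynomial in $|x|$, for every oracle and every outcome of all coins; reading an oracle answer is charged by the number of bits read. In $R^{\mathcal A}$, every oracle query is answered by $\mathcal A$ with fresh randomness. **Protocols.** Let $\mathcal L\in\mathsf{NP}$ with NP relation $\mathcal R_{\mathcal L}$. A public-coin protocol has $k=k(n)$ rounds on inputs $x\in\{0,1\}^n$. In round $i$ a uniformly random string $r_i$ of a length $m_i(n)$ is sent to the prover, who answers with $\pi_i$, sampled as a function of $x$, (for the honest prover) a witness $w$, and $r_1,\pi_1,\dots,r_i$; honest messages are polynomially long. At the end a deterministic polynomial-time verifier accepts or rejects $(x;r_1,\pi_1,\dots,r_k,\pi_k)$; $(m_i(n))_{i\le k(n)}$,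 in unary, is computable in time polynomial in $n$. The protocol has $t(n)$ messages, where $t(n)=2k(n)$, or $t(n)=2k(n)-1$ if $m_1(n)=0$ (the prover moves first). For $\epsilon_c,\epsilon_s,\epsilon_z:\mathbb N\to[0,1]$ it is an $(\epsilon_c,\epsilon_s,\epsilon_z)$-ZK *proof* for $\mathcal L$ if: * (completeness) for all $(x,w)\in\mathcal R_{\mathcal L}$ with $|x|=n$, the verifier accepts in the interaction with the honest prover with probability at least $1-\epsilon_c(n)$; * (soundness) for every $x\in\{0,1\}^n\setminus\mathcal L_n$ and every prover $\mathsf P^*$, the verifier accepts with probability at most $\epsilon_s(n)$; * (computational zero-knowledge) there is a PPT simulator $\mathsf{Sim}$ such that for every non-uniform PPT distinguisher $D$, all large enough $n$, and all $(x,w)\in\mathcal R_{\mathcal L}$ with $|x|=n$, the distinguishing advantage of $D$ between $\mathsf{Sim}(x)$ and the transcript of the honest interaction on $(x,w)$ is at most $\epsilon_z(n)$. It is an $(\epsilon_c,\epsilon_s,\epsilon_z)$-ZK *argument* if the honest prover is PPT and soundness is only required against PPT provers $\mathsf P^*$ with polynomially long messages (for each such $\mathsf P^*$, for all large enough $n$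 and all $x\in\{0,1\}^n\setminus\mathcal L_n$). **Lemma.** Let $\epsilon_c,\epsilon_s,\epsilon_z:\mathbb N\to[0,1]$ and $t:\mathbb N\to\mathbb N$ with $t(n)\ge 2$ for all $n$. Suppose that a language $\mathcal L\in\mathsf{NP}$ has an $(\epsilon_c,\epsilon_s,\epsilon_z)$-public-coin ZK proof or argument with $t$ messages. Then there exist a polynomial-time oracle-aided algorithm $R$, polynomials $m_1',m_2'$ and a polynomial-time computable function family $\mathcal F=\{f_x:\{0,1\}^{m_1'(|x|)}\to\{0,1\}^{m_2'(|x|)}\}_{x\in\{0,1\}^*}$ such that for every PPT algorithm $\mathcal A$, every polynomial $p$, and all large enough $n\in\mathbb N$: 1. For every $x\in\mathcal L_n$, if $\mathcal A$ distributionally inverts $f_x$ with deviation at most $1/p(n)$, i.e. $\Delta_s\big((u,f_x(u));(\mathcal A(x,f_x(u)),f_x(u))\big)\le 1/p(n)$ for $u\gets\mathcal U_{m_1'(n)}$, then $$\Pr[R^{\mathcal A}(x)=1]\ \ge\ 1-\epsilon_c(n)-(t(n)-1)\,\epsilon_z(n)-\frac{t(n)}{p(n)}.$$ 2. For every $x\in\{0,1\}^n\setminus\mathcal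 L_n$, $\Pr[R^{\mathcal A}(x)=1]\le\epsilon_s(n)$. -/

import Mathlib

namespace PublicCoinZK

/-! ### Machine model: while programs over finite binary trees, with a step count -/

/-- The data of the machine model: finite binary trees whose leaves carry a bit. -/
inductive Val : Type
  | atom (b : Bool)
  | node (l r : Val)

namespace Val

/-- Number of vertices. -/
def size : Val → ℕ
  | atom _ => 1
  | node l r => l.size + r.size + 1

/-- Left component (an atom is left unchanged). -/
def fst : Val → Val
  | atom b => atom b
  | node l _ => l

/-- Right component (an atom is left unchanged). -/
def snd : Val → Val
  | atom b => atom b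
  | node _ r => r

/-- Is the value the atom `true`? -/
def isTrue : Val → Bool
  | atom b => b
  | node _ _ => false

/-- Is the value a node? -/
def isNode : Val → Bool
  | atom _ => false
  | node _ _ => true

/-- Read a value as a bit string: the left components along the right spine. On the encoding of a
bit string (see `HasVal` below) this returns that string. -/
def toBits : Val → List Bool
  | atom _ => []
  | node l r => l.isTrue :: r.toBits

end Val

/-- Types whose elements are written down as trees. -/
class HasVal (α : Type) where
  enc : α → Val

/-- The tree encoding a list. -/
def encList {α : Type} [HasVal α] : List α → Val
  | [] => .atom false
  | a :: l => .node (HasVal.enc a) (encList l)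

instance : HasVal Bool := ⟨Val.atom⟩

instance {α : Type} [HasVal α] : HasVal (List α) := ⟨encList⟩

instance {α β : Type} [HasVal α] [HasVal β] : HasVal (α × β) :=
  ⟨fun a => .node (HasVal.enc a.1) (HasVal.enc a.2)⟩

/-- Size of the encoding of `a`, the input size in which running times are measured. A bit string
of length `n` has size `2 * n + 1`. -/
def inputSize {α : Type} [HasVal α] (a : α) : ℕ := (HasVal.enc a).size

/-- Programs. A program transforms a value; `while t c` repeats `c` as long as the test `t` returns
`true` on the current value, and `ask` is the oracle instruction. -/
inductive Code : Type
  | const (b : Bool)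
  | id
  | fst
  | snd
  | isNode
  | pair (c d : Code)
  | seq (c d : Code)
  | ite (t c d : Code)
  | while (t c : Code)
  | ask

/-- An oracle takes a query consisting of two strings and answers with a string, in a monad `m`
(`m = PMF` for randomized oracles, which answer each query with fresh randomness). -/
abbrev Oracle (m : Type → Type) : Type := List Bool × List Bool → m (List Bool)

/-- At most `N` iterations of a while loop with test `t` and body `c`, where `t` and `c` return
their result together with the number of steps they took. -/
def whileLoop {m : Type → Type} [Monad m] (t c : Val → m (Val × ℕ)) : ℕ → Val → m (Val × ℕ)
  | 0, v => pure (v, v.size + 1)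
  | N + 1, v => do
    let b ← t v
    if b.1.isTrue then
      let u ← c v
      let w ← whileLoop t c N u.1
      pure (w.1, b.2 + u.2 + w.2)
    else
      pure (v, b.2 + v.size + 1)

/-- `c.run O N v` is the result of the program `c` on the value `v` with the oracle `O`, together
with the number of steps taken. Every elementary operation is charged the size of the data that it
handles. The number `N` is a time budget: loops are cut off after `N` iterations. Every iteration
takes at least two steps, so a run in which a loop was cut off reports more than `N` steps, and a
run that reports at most `N` steps was not cut off: it is the complete run of the program.

The operand of `ask` is a triple `(bound, (y, z))`. The query `(y, z)` is sent to the oracle and the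
answer is read up to the length of the string `bound`, so that the program pays for the part of the
answer that it reads. -/
def Code.run {m : Type → Type} [Monad m] (O : Oracle m) (N : ℕ) : Code → Val → m (Val × ℕ)
  | .const b, v => pure (.atom b, v.size + 1)
  | .id, v => pure (v, v.size + 1)
  | .fst, v => pure (v.fst, v.size + 1)
  | .snd, v => pure (v.snd, v.size + 1)
  | .isNode, v => pure (.atom v.isNode, v.size + 1)
  | .pair c d, v => do
    let a ← c.run O N v
    let b ← d.run O N v
    pure (.node a.1 b.1, a.2 + b.2 + v.size + 1)
  | .seq c d, v => do
    let a ← c.run O N v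
    let b ← d.run O N a.1
    pure (b.1, a.2 + b.2 + 1)
  | .ite t c d, v => do
    let b ← t.run O N v
    let u ← if b.1.isTrue then c.run O N v else d.run O N v
    pure (u.1, b.2 + u.2 + v.size + 1)
  | .while t c, v => whileLoop (t.run O N) (c.run O N) N v
  | .ask, v => do
    let a ← O (v.snd.fst.toBits, v.snd.snd.toBits)
    let u : Val := HasVal.enc (a.take v.fst.toBits.length)
    pure (u, v.size + u.size + 1)

/-- The program contains no oracle instruction. -/
def Code.OracleFree : Code → Prop
  | .ask => False
  | .pair c d => c.OracleFree ∧ d.OracleFree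
  | .seq c d => c.OracleFree ∧ d.OracleFree
  | .ite t c d => t.OracleFree ∧ c.OracleFree ∧ d.OracleFree
  | .while t c => t.OracleFree ∧ c.OracleFree
  | _ => True

/-! ### Polynomial-time, probabilistic polynomial-time and oracle-aided algorithms -/

/-- `f` is computed by a deterministic program (without oracle) in a number of steps that is
polynomial in the size of the input. -/
def PolyTime {α β : Type} [HasVal α] [HasVal β] (f : α → β) : Prop :=
  ∃ (c : Code) (p : Polynomial ℕ), c.OracleFree ∧ ∀ a : α,
    let r : Val × ℕ :=
      Id.run (c.run (m := Id) (fun _ => pure []) (p.eval (inputSize a)) (HasVal.enc a))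
    r.1 = HasVal.enc (f a) ∧ r.2 ≤ p.eval (inputSize a)

/-- The uniform distribution on the bit strings of length `n`. -/
noncomputable def unif (n : ℕ) : PMF (List Bool) :=
  (PMF.uniformOfFintype (Fin n → Bool)).map List.ofFn

/-- `A` is a probabilistic polynomial-time algorithm: its output on `a` is computed in
deterministic polynomial time from `a` and polynomially many uniform coins. -/
def PPT {α β : Type} [HasVal α] [HasVal β] (A : α → PMF β) : Prop :=
  ∃ (h : α × List Bool → β) (q : Polynomial ℕ), PolyTime h ∧
    ∀ a : α, A a = (unif (q.eval (inputSize a))).map fun ρ => h (a, ρ)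

/-- `R` is a (probabilistic) polynomial-time oracle-aided algorithm with one-bit output: one program
takes the input and polynomially many uniform coins and, for every oracle and every outcome of the
coins and of the oracle, stops after a number of steps that is polynomial in the input length. -/
def OraclePolyTime (R : Oracle PMF → List Bool → PMF Bool) : Prop :=
  ∃ (c : Code) (p q : Polynomial ℕ), ∀ (O : Oracle PMF) (x : List Bool),
    (∀ ρ : List Bool, ρ.length = q.eval x.length →
      ∀ o ∈ (c.run O (p.eval x.length) (HasVal.enc (x, ρ))).support, o.2 ≤ p.eval x.length) ∧
    R O x = (unif (q.eval x.length)).bind fun ρ =>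
      (c.run O (p.eval x.length) (HasVal.enc (x, ρ))).map fun o => o.1.isTrue

/-! ### Statistical distance and distributional inversion -/

/-- Statistical distance. -/
noncomputable def statDist {α : Type} (P Q : PMF α) : ℝ :=
  (1 / 2) * ∑' u, |(P u).toReal - (Q u).toReal|

/-- `A` distributionally inverts `f x`, as a function on the strings of length `m`, with deviation
at most `δ`: the distributions `(ρ, f x ρ)` and `(A (x, f x ρ), f x ρ)`, for uniform `ρ`, are at
statistical distance at most `δ`. -/
def DistInverts (A : List Bool × List Bool → PMF (List Bool)) (f : List Bool → List Bool → List Bool)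
    (x : List Bool) (m : ℕ) (δ : ℝ) : Prop :=
  statDist ((unif m).map fun ρ => (ρ, f x ρ))
    ((unif m).bind fun ρ => (A (x, f x ρ)).map fun ρ' => (ρ', f x ρ)) ≤ δ

/-- `f = (f x)` is a polynomial-time computable function family in which `f x` maps strings of
length `m₁ |x|` to strings of length `m₂ |x|`. -/
def IsPolyTimeFamily (f : List Bool → List Bool → List Bool) (m₁ m₂ : Polynomial ℕ) : Prop :=
  PolyTime (fun a : List Bool × List Bool => f a.1 a.2) ∧
  ∀ x ρ : List Bool, ρ.length = m₁.eval x.length → (f x ρ).length = m₂.eval x.length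

/-! ### NP relations and public-coin zero-knowledge protocols -/

/-- `Rel` is an NP relation for the language `L`. -/
def IsNPRelation (L : Language Bool) (Rel : List Bool → List Bool → Prop) : Prop :=
  (∃ d : List Bool × List Bool → Bool, PolyTime d ∧ ∀ x w, Rel x w ↔ d (x, w) = true) ∧
  (∃ b : Polynomial ℕ, ∀ x w, Rel x w → w.length ≤ b.eval x.length) ∧
  ∀ x, x ∈ L ↔ ∃ w, Rel x w

/-- A transcript `(r₁, π₁), …, (rₖ, πₖ)`, possibly partial. -/
abbrev Transcript : Type := List (List Bool × List Bool)

/-- A prover strategy: given the transcript of the previous rounds and the random string of the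
current round, it samples a message. -/
abbrev Strategy : Type := Transcript → List Bool → PMF (List Bool)

/-- A public-coin protocol. On inputs of length `n` it has `(coins n).length` rounds, and the
verifier's random string in a round has the length listed in `coins n`. -/
structure Protocol where
  coins : ℕ → List ℕ
  /-- The honest prover, given the instance and a witness. -/
  prover : List Bool → List Bool → Strategy
  /-- The verifier's decision, given the instance and the full transcript. -/
  verifier : List Bool → Transcript → Bool

/-- Continue the transcript `τ` with rounds whose random strings have the lengths in the list: in
each round a uniform string is sampled and the prover responds. -/
noncomputable def interact (P : Strategy) : List ℕ → Transcript → PMF Transcript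
  | [], τ => PMF.pure τ
  | m :: ms, τ => (unif m).bind fun r => (P τ r).bind fun π => interact P ms (τ ++ [(r, π)])

namespace Protocol

variable (Γ : Protocol)

/-- The transcript of an execution on instance `x` with the prover strategy `P`. -/
noncomputable def view (P : Strategy) (x : List Bool) : PMF Transcript :=
  interact P (Γ.coins x.length) []

/-- The probability that the verifier accepts in an execution with prover strategy `P`. -/
noncomputable def acceptProb (P : Strategy) (x : List Bool) : ℝ :=
  ((Γ.view P x).map (Γ.verifier x) true).toReal

/-- The protocol has `t n` messages on inputs of length `n`: two per round, or one less if the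
prover moves first, in which case the verifier's first message is the empty string. -/
def HasMessages (t : ℕ → ℕ) : Prop :=
  ∀ n, t n = 2 * (Γ.coins n).length ∨
    (t n + 1 = 2 * (Γ.coins n).length ∧ (Γ.coins n).head? = some 0)

/-- The verifier is efficient: the lengths of its random strings (in unary) and its decision are
computable in deterministic polynomial time. -/
def EfficientVerifier : Prop :=
  PolyTime (fun x : List Bool => (Γ.coins x.length).map fun m => List.replicate m true) ∧
  PolyTime (fun a : List Bool × Transcript => Γ.verifier a.1 a.2)

/-- The honest prover's messages are polynomially long. -/
def PolyMessages (Rel : List Bool → List Bool → Prop) : Prop :=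
  ∃ b : Polynomial ℕ, ∀ x w, Rel x w → ∀ τ r, ∀ π ∈ (Γ.prover x w τ r).support,
    π.length ≤ b.eval x.length

/-- Completeness with error `ε`. -/
def Complete (Rel : List Bool → List Bool → Prop) (ε : ℕ → ℝ) : Prop :=
  ∀ x w, Rel x w → 1 - ε x.length ≤ Γ.acceptProb (Γ.prover x w) x

/-- Soundness with error `ε` against all provers. -/
def Sound (L : Language Bool) (ε : ℕ → ℝ) : Prop :=
  ∀ x, x ∉ L → ∀ P : Strategy, Γ.acceptProb P x ≤ ε x.length

/-- Soundness with error `ε` against efficient provers: for every prover that samples its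
(polynomially long) messages in probabilistic polynomial time, the bound holds on all inputs outside
the language that are long enough. -/
def ComputationallySound (L : Language Bool) (ε : ℕ → ℝ) : Prop :=
  ∀ P : List Bool → Strategy,
    PPT (fun a : List Bool × Transcript × List Bool => P a.1 a.2.1 a.2.2) →
    (∃ b : Polynomial ℕ, ∀ x τ r, ∀ π ∈ (P x τ r).support, π.length ≤ b.eval x.length) →
    ∀ᶠ n in Filter.atTop, ∀ x : List Bool, x.length = n → x ∉ L → Γ.acceptProb (P x) x ≤ ε n

/-- Computational zero-knowledge with error `ε`: the output of some probabilistic polynomial-time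
simulator is `ε`-indistinguishable from the view, for non-uniform probabilistic polynomial-time
distinguishers `D` (which are given an advice string `z n` of polynomial length) and all large
enough `n`. -/
def ZeroKnowledge (Rel : List Bool → List Bool → Prop) (ε : ℕ → ℝ) : Prop :=
  ∃ Sim : List Bool → PMF Transcript, PPT Sim ∧
    ∀ D : List Bool × List Bool × Transcript → PMF Bool, PPT D →
    ∀ z : ℕ → List Bool, (∃ b : Polynomial ℕ, ∀ n, (z n).length ≤ b.eval n) →
    ∀ᶠ n in Filter.atTop, ∀ x w : List Bool, x.length = n → Rel x w →
      |(((Sim x).bind fun τ => D (z n, x, τ)) true).toReal -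
        (((Γ.view (Γ.prover x w) x).bind fun τ => D (z n, x, τ)) true).toReal| ≤ ε n

/-- The honest prover runs in probabilistic polynomial time. -/
def EfficientProver : Prop :=
  PPT fun a : (List Bool × List Bool) × Transcript × List Bool =>
    Γ.prover a.1.1 a.1.2 a.2.1 a.2.2

/-- A public-coin `(εc, εs, εz)`-zero-knowledge proof. -/
def IsZKProof (L : Language Bool) (Rel : List Bool → List Bool → Prop) (εc εs εz : ℕ → ℝ) : Prop :=
  Γ.EfficientVerifier ∧ Γ.PolyMessages Rel ∧
    Γ.Complete Rel εc ∧ Γ.Sound L εs ∧ Γ.ZeroKnowledge Rel εz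

/-- A public-coin `(εc, εs, εz)`-zero-knowledge argument. -/
def IsZKArgument (L : Language Bool) (Rel : List Bool → List Bool → Prop) (εc εs εz : ℕ → ℝ) :
    Prop :=
  Γ.EfficientVerifier ∧ Γ.PolyMessages Rel ∧ Γ.EfficientProver ∧
    Γ.Complete Rel εc ∧ Γ.ComputationallySound L εs ∧ Γ.ZeroKnowledge Rel εz

end Protocol

end PublicCoinZK

open PublicCoinZK

namespace PublicCoinZK

/-! ### Big-step semantics -/

/-! The function `Simulator.fn` picks a round, runs the zero-knowledge simulator, and returns the
simulated transcript up to the verifier's string of that round, with one extra bit that in the last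
round records acceptance. A preimage contains a prover message that fits the given past, so an
inverter yields a cheating prover, `Simulator.prover`, which always asks for the extra bit to be
`true`. The reduction plays the verifier against this prover. Outside the language its acceptance
probability is therefore bounded by soundness itself; for arguments this uses that the prover is
efficient when the inverter is.

On the language one compares hybrids. Keep the first `j` rounds of a transcript and let the cheating
prover finish: acceptance has probability `v j` for the honest view and `a j` for the simulator. If
the verifier's next string is kept as well, the probabilities are `u j` and `c j`. Then `v 0`
belongs to the reduction and `v k` to the honest execution, `v j = u j` because coins are public and
uniform (`view_bind_before`), and zero-knowledge gives `a j ≈ v j` and `c j ≈ u j`. The step from `a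
(j + 1)` to `c j` replaces a simulated message by an inverter's message. One use of distributional
inversion pays for all rounds together: each round is picked with probability at least `1 / t`, so
the total loss is at most `t * δ` (`sum_gap_le`).

Two applications of zero-knowledge per round would cost one `εz` too many. In the last round, thanks
to the extra bit, the single test "the transcript is accepted, but the cheating prover fails after
its last random string" replaces both. If the prover moves first, the first comparison of `c 0` with
`u 0` is exact. This gives `t - 1` in both cases (`hybrid_chain`, `reduction_ge`).

The remainder is complexity theory in the concrete machine model: closure properties of `FP` and
`PPT`, and `oraclePolyTime_loop` for programs that query an oracle in a loop. -/

lemma Val.one_le_size (v : Val) : 1 ≤ v.size := by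
  cases v <;> simp [Val.size]

lemma Val.fst_size_le (v : Val) : v.fst.size ≤ v.size := by
  cases v <;> simp [Val.fst, Val.size]; omega

lemma Val.snd_size_le (v : Val) : v.snd.size ≤ v.size := by
  cases v <;> simp [Val.snd, Val.size]; omega

/-- `Eval c v u s`: the program `c`, without using the oracle, transforms `v` into `u` in `s`
steps. -/
inductive Eval : Code → Val → Val → ℕ → Prop
  | const (b : Bool) (v : Val) : Eval (.const b) v (.atom b) (v.size + 1)
  | id (v : Val) : Eval .id v v (v.size + 1)
  | fst (v : Val) : Eval .fst v v.fst (v.size + 1)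
  | snd (v : Val) : Eval .snd v v.snd (v.size + 1)
  | isNode (v : Val) : Eval .isNode v (.atom v.isNode) (v.size + 1)
  | pair {c d : Code} {v a b : Val} {s s' : ℕ} (hc : Eval c v a s) (hd : Eval d v b s') :
      Eval (.pair c d) v (.node a b) (s + s' + v.size + 1)
  | seq {c d : Code} {v a b : Val} {s s' : ℕ} (hc : Eval c v a s) (hd : Eval d a b s') :
      Eval (.seq c d) v b (s + s' + 1)
  | ite_true {t c d : Code} {v b u : Val} {s s' : ℕ} (ht : Eval t v b s) (hb : b.isTrue = true)
      (hc : Eval c v u s') : Eval (.ite t c d) v u (s + s' + v.size + 1)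
  | ite_false {t c d : Code} {v b u : Val} {s s' : ℕ} (ht : Eval t v b s) (hb : b.isTrue = false)
      (hd : Eval d v u s') : Eval (.ite t c d) v u (s + s' + v.size + 1)
  | while_true {t c : Code} {v b u w : Val} {s s' s'' : ℕ} (ht : Eval t v b s)
      (hb : b.isTrue = true) (hc : Eval c v u s') (hw : Eval (.while t c) u w s'') :
      Eval (.while t c) v w (s + s' + s'')
  | while_false {t c : Code} {v b : Val} {s : ℕ} (ht : Eval t v b s) (hb : b.isTrue = false) :
      Eval (.while t c) v v (s + v.size + 1)

lemma Eval.size_le {c : Code} {v u : Val} {s : ℕ} (h : Eval c v u s) : u.size ≤ s := by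
  induction h with
  | const => simp [Val.size]
  | id => simp
  | fst v => have := v.fst_size_le; omega
  | snd v => have := v.snd_size_le; omega
  | isNode => simp [Val.size]
  | pair => simp only [Val.size]; omega
  | seq => omega
  | ite_true => omega
  | ite_false => omega
  | while_true => omega
  | while_false => omega

lemma Eval.pos {c : Code} {v u : Val} {s : ℕ} (h : Eval c v u s) : 1 ≤ s :=
  u.one_le_size.trans h.size_le

/-- The second conjunct separates the remaining iterations `M` of a loop from the budget `N` of its
body, as the induction along a loop lowers only `M`. Fuel `s` is enough because every iteration
takes at least one step. -/
lemma Eval.run_aux {m : Type → Type} [Monad m] [LawfulMonad m] (O : Oracle m) {c : Code}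
    {v u : Val} {s : ℕ} (h : Eval c v u s) : ∀ N, s ≤ N →
      c.run O N v = pure (u, s) ∧
      ∀ t d, c = .while t d → ∀ M, s ≤ M →
        whileLoop (t.run O N) (d.run O N) M v = pure (u, s) := by
  induction h with
  | const b v => intro N hN; simp [Code.run]
  | id v => intro N hN; simp [Code.run]
  | fst v => intro N hN; simp [Code.run]
  | snd v => intro N hN; simp [Code.run]
  | isNode v => intro N hN; simp [Code.run]
  | pair hc hd ihc ihd =>
    intro N hN
    simp [Code.run, (ihc N (by omega)).1, (ihd N (by omega)).1]
  | seq hc hd ihc ihd =>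
    intro N hN
    simp [Code.run, (ihc N (by omega)).1, (ihd N (by omega)).1]
  | ite_true ht hb hc iht ihc =>
    intro N hN
    simp [Code.run, (iht N (by omega)).1, (ihc N (by omega)).1, hb]
  | ite_false ht hb hd iht ihd =>
    intro N hN
    simp [Code.run, (iht N (by omega)).1, (ihd N (by omega)).1, hb]
  | @while_true t c v b u w s s' s'' ht hb hc hw iht ihc ihw =>
    intro N hN
    have key : ∀ M, s + s' + s'' ≤ M →
        whileLoop (t.run O N) (c.run O N) M v = pure (w, s + s' + s'') := by
      intro M hM
      obtain ⟨M, rfl⟩ : ∃ M', M = M' + 1 := ⟨M - 1, by have := ht.pos; omega⟩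
      have := ht.pos
      simp [whileLoop, (iht N (by omega)).1, (ihc N (by omega)).1, hb,
        (ihw N (by omega)).2 t c rfl M (by omega)]
    refine ⟨by simpa [Code.run] using key N hN, ?_⟩
    rintro t' d' ⟨⟩ M hM
    exact key M hM
  | @while_false t c v b s ht hb iht =>
    intro N hN
    have key : ∀ M, s + v.size + 1 ≤ M →
        whileLoop (t.run O N) (c.run O N) M v = pure (v, s + v.size + 1) := by
      intro M hM
      obtain ⟨M, rfl⟩ : ∃ M', M = M' + 1 := ⟨M - 1, by omega⟩
      simp [whileLoop, (iht N (by omega)).1, hb]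
    refine ⟨by simpa [Code.run] using key N hN, ?_⟩
    rintro t' d' ⟨⟩ M hM
    exact key M hM

lemma Eval.run {m : Type → Type} [Monad m] [LawfulMonad m] (O : Oracle m) {c : Code}
    {v u : Val} {s N : ℕ} (h : Eval c v u s) (hN : s ≤ N) : c.run O N v = pure (u, s) :=
  (h.run_aux O N hN).1

/-- A loop that is cut off reports more steps than it had fuel: the cut-off costs at least one step,
and so does each iteration. A report within the budget thus comes from a genuine derivation. -/
lemma eval_of_run (O : Oracle Id) (N : ℕ) {c : Code} (hc : c.OracleFree) :
    ∀ v, (c.run (m := Id) O N v).2 ≤ N →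
      Eval c v (c.run (m := Id) O N v).1 (c.run (m := Id) O N v).2 := by
  induction c with
  | const b => intro v _; exact .const b v
  | id => intro v _; exact .id v
  | fst => intro v _; exact .fst v
  | snd => intro v _; exact .snd v
  | isNode => intro v _; exact .isNode v
  | pair c d ihc ihd =>
    intro v hv
    change (c.run (m := Id) O N v).2 + (d.run (m := Id) O N v).2 + v.size + 1 ≤ N at hv
    exact .pair (ihc hc.1 v (by omega)) (ihd hc.2 v (by omega))
  | seq c d ihc ihd =>
    intro v hv
    change (c.run (m := Id) O N v).2 + (d.run (m := Id) O N (c.run (m := Id) O N v).1).2 + 1 ≤ N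
      at hv
    exact .seq (ihc hc.1 v (by omega)) (ihd hc.2 _ (by omega))
  | ite t c d iht ihc ihd =>
    intro v hv
    rcases hb : (t.run (m := Id) O N v).1.isTrue with _ | _
    · have e : (Code.ite t c d).run (m := Id) O N v = ((d.run (m := Id) O N v).1,
          (t.run (m := Id) O N v).2 + (d.run (m := Id) O N v).2 + v.size + 1) := by
        change (if (t.run (m := Id) O N v).1.isTrue = true then
          ((c.run (m := Id) O N v).1,
            (t.run (m := Id) O N v).2 + (c.run (m := Id) O N v).2 + v.size + 1)
          else ((d.run (m := Id) O N v).1,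
            (t.run (m := Id) O N v).2 + (d.run (m := Id) O N v).2 + v.size + 1)) = _
        rw [hb]; rfl
      rw [e] at hv ⊢
      exact .ite_false (iht hc.1 v (by simp only at hv; omega)) hb
        (ihd hc.2.2 v (by simp only at hv; omega))
    · have e : (Code.ite t c d).run (m := Id) O N v = ((c.run (m := Id) O N v).1,
          (t.run (m := Id) O N v).2 + (c.run (m := Id) O N v).2 + v.size + 1) := by
        change (if (t.run (m := Id) O N v).1.isTrue = true then
          ((c.run (m := Id) O N v).1,
            (t.run (m := Id) O N v).2 + (c.run (m := Id) O N v).2 + v.size + 1)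
          else ((d.run (m := Id) O N v).1,
            (t.run (m := Id) O N v).2 + (d.run (m := Id) O N v).2 + v.size + 1)) = _
        rw [hb]; rfl
      rw [e] at hv ⊢
      exact .ite_true (iht hc.1 v (by simp only at hv; omega)) hb
        (ihc hc.2.1 v (by simp only at hv; omega))
  | ask => exact hc.elim
  | _ =>
    rename_i t c iht ihc
    have key : ∀ M v, (whileLoop (m := Id) (t.run O N) (c.run O N) M v).2 ≤ N →
        (whileLoop (m := Id) (t.run O N) (c.run O N) M v).2 ≤ M →
        Eval (.while t c) v (whileLoop (m := Id) (t.run O N) (c.run O N) M v).1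
          (whileLoop (m := Id) (t.run O N) (c.run O N) M v).2 := by
      intro M
      induction M with
      | zero => intro v _ h; change v.size + 1 ≤ 0 at h; omega
      | succ M ih =>
        intro v h1 h2
        have e : whileLoop (m := Id) (t.run O N) (c.run O N) (M + 1) v =
          if (t.run (m := Id) O N v).1.isTrue then
            ((whileLoop (m := Id) (t.run O N) (c.run O N) M (c.run (m := Id) O N v).1).1,
              (t.run (m := Id) O N v).2 + (c.run (m := Id) O N v).2 +
              (whileLoop (m := Id) (t.run O N) (c.run O N) M (c.run (m := Id) O N v).1).2)
          else (v, (t.run (m := Id) O N v).2 + v.size + 1) := rfl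
        rw [e] at h1 h2 ⊢
        rcases hb : (t.run (m := Id) O N v).1.isTrue with _ | _
        · simp only [hb, Bool.false_eq_true, if_false] at h1 h2 ⊢
          exact .while_false (iht hc.1 v (by omega)) hb
        · simp only [hb, if_true] at h1 h2 ⊢
          have ht := iht hc.1 v (by omega)
          have := ht.pos
          exact .while_true ht hb (ihc hc.2 v (by omega)) (ih _ (by omega) (by omega))
    intro v hv
    exact key N v hv hv

/-! ### Functions computable in polynomial time -/

lemma eval_poly_mono (p : Polynomial ℕ) {a b : ℕ} (h : a ≤ b) : p.eval a ≤ p.eval b := by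
  induction p using Polynomial.induction_on' with
  | add p q hp hq => simpa using add_le_add hp hq
  | monomial n c => simpa using Nat.mul_le_mul_left c (Nat.pow_le_pow_left h n)

/-- `f` is computable in polynomial time, in terms of the big-step semantics. -/
def FP {α β : Type} [HasVal α] [HasVal β] (f : α → β) : Prop :=
  ∃ (c : Code) (p : Polynomial ℕ), c.OracleFree ∧ ∀ a : α,
    ∃ s ≤ p.eval (inputSize a), Eval c (HasVal.enc a) (HasVal.enc (f a)) s

/-- This removes the time budget from the closure proofs, which can work with derivations only. -/
lemma fp_iff {α β : Type} [HasVal α] [HasVal β] {f : α → β} : FP f ↔ PolyTime f := by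
  constructor
  · rintro ⟨c, p, hc, h⟩
    refine ⟨c, p, hc, fun a => ?_⟩
    obtain ⟨s, hs, he⟩ := h a
    have := he.run (m := Id) (fun _ => pure []) hs
    simp only [this]
    exact ⟨rfl, hs⟩
  · rintro ⟨c, p, hc, h⟩
    refine ⟨c, p, hc, fun a => ?_⟩
    obtain ⟨h1, h2⟩ := h a
    have := eval_of_run (fun _ => pure []) (p.eval (inputSize a)) hc (HasVal.enc a) h2
    refine ⟨_, h2, ?_⟩
    rw [← h1]
    exact this

variable {α β γ δ σ : Type} [HasVal α] [HasVal β] [HasVal γ] [HasVal δ] [HasVal σ]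

/-- Writing the output is charged, so the running time bounds its size. Most later bounds on states
and messages come from this. -/
lemma FP.size_le {f : α → β} (hf : FP f) :
    ∃ p : Polynomial ℕ, ∀ a, inputSize (f a) ≤ p.eval (inputSize a) := by
  obtain ⟨c, p, -, h⟩ := hf
  refine ⟨p, fun a => ?_⟩
  obtain ⟨s, hs, he⟩ := h a
  exact he.size_le.trans hs

lemma one_le_inputSize (a : α) : 1 ≤ inputSize a := Val.one_le_size _

lemma inputSize_pair (a : α) (b : β) : inputSize (a, b) = inputSize a + inputSize b + 1 := rfl

lemma FP.id : FP fun a : α => a :=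
  ⟨.id, .X + 1, trivial, fun a => ⟨_, by simp [inputSize], .id _⟩⟩

lemma FP.fst : FP fun a : α × β => a.1 :=
  ⟨.fst, .X + 1, trivial, fun a => ⟨_, by simp [inputSize], .fst _⟩⟩

lemma FP.snd : FP fun a : α × β => a.2 :=
  ⟨.snd, .X + 1, trivial, fun a => ⟨_, by simp [inputSize], .snd _⟩⟩

lemma FP.comp {g : β → γ} {f : α → β} (hg : FP g) (hf : FP f) : FP fun a => g (f a) := by
  obtain ⟨c, p, hc, h⟩ := hf
  obtain ⟨d, q, hd, h'⟩ := hg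
  refine ⟨.seq c d, p + q.comp p + 1, ⟨hc, hd⟩, fun a => ?_⟩
  obtain ⟨s, hs, he⟩ := h a
  obtain ⟨s', hs', he'⟩ := h' (f a)
  refine ⟨_, ?_, .seq he he'⟩
  have := eval_poly_mono q (he.size_le.trans hs)
  simp only [Polynomial.eval_add, Polynomial.eval_comp, Polynomial.eval_one]
  unfold inputSize at *
  omega

lemma FP.pair {f : α → β} {g : α → γ} (hf : FP f) (hg : FP g) : FP fun a => (f a, g a) := by
  obtain ⟨c, p, hc, h⟩ := hf
  obtain ⟨d, q, hd, h'⟩ := hg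
  refine ⟨.pair c d, p + q + .X + 1, ⟨hc, hd⟩, fun a => ?_⟩
  obtain ⟨s, hs, he⟩ := h a
  obtain ⟨s', hs', he'⟩ := h' a
  refine ⟨_, ?_, .pair he he'⟩
  simp only [Polynomial.eval_add, Polynomial.eval_one, Polynomial.eval_X]
  unfold inputSize at *
  omega

lemma FP.ite {b : α → Bool} {f g : α → β} (hb : FP b) (hf : FP f) (hg : FP g) :
    FP fun a => if b a = true then f a else g a := by
  obtain ⟨t, p, ht, h⟩ := hb
  obtain ⟨c, q, hc, h'⟩ := hf
  obtain ⟨d, r, hd, h''⟩ := hg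
  refine ⟨.ite t c d, p + q + r + .X + 1, ⟨ht, hc, hd⟩, fun a => ?_⟩
  obtain ⟨s, hs, he⟩ := h a
  obtain ⟨s', hs', he'⟩ := h' a
  obtain ⟨s'', hs'', he''⟩ := h'' a
  simp only [Polynomial.eval_add, Polynomial.eval_one, Polynomial.eval_X]
  rcases hba : b a with _ | _
  · rw [hba] at he
    refine ⟨_, ?_, .ite_false he rfl he''⟩
    unfold inputSize at *
    omega
  · rw [hba] at he
    refine ⟨_, ?_, .ite_true he rfl he'⟩
    unfold inputSize at *
    omega

/-- A program that returns the value `v` on every input. -/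
def constCode : Val → Code
  | .atom b => .const b
  | .node l r => .pair (constCode l) (constCode r)

lemma constCode_oracleFree (v : Val) : (constCode v).OracleFree := by
  induction v with
  | atom b => trivial
  | node l r hl hr => exact ⟨hl, hr⟩

lemma eval_constCode (v : Val) : ∃ p : Polynomial ℕ, ∀ u : Val, ∃ s ≤ p.eval u.size,
    Eval (constCode v) u v s := by
  induction v with
  | atom b => exact ⟨.X + 1, fun u => ⟨_, by simp, .const b u⟩⟩
  | node l r hl hr =>
    obtain ⟨p, hp⟩ := hl
    obtain ⟨q, hq⟩ := hr
    refine ⟨p + q + .X + 1, fun u => ?_⟩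
    obtain ⟨s, hs, he⟩ := hp u
    obtain ⟨s', hs', he'⟩ := hq u
    refine ⟨_, ?_, .pair he he'⟩
    simp only [Polynomial.eval_add, Polynomial.eval_one, Polynomial.eval_X]
    omega

lemma FP.const (b : β) : FP fun _ : α => b := by
  obtain ⟨p, hp⟩ := eval_constCode (HasVal.enc b)
  exact ⟨_, p, constCode_oracleFree _, fun a => hp _⟩

/-- Functions with the same encoded values are computable by the same programs. -/
lemma FP.of_enc_eq {α' β' : Type} [HasVal α'] [HasVal β'] {f : α → β} (hf : FP f)
    (φ : α' → α) (f' : α' → β') (hφ : ∀ a, HasVal.enc (φ a) = HasVal.enc a)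
    (h : ∀ a, HasVal.enc (f (φ a)) = HasVal.enc (f' a)) : FP f' := by
  obtain ⟨c, p, hc, hf⟩ := hf
  refine ⟨c, p, hc, fun a => ?_⟩
  have := hf (φ a)
  rw [h] at this
  unfold inputSize at *
  rwa [hφ] at this

lemma FP.congr {f g : α → β} (hf : FP f) (h : ∀ a, f a = g a) : FP g := by
  rwa [show g = f from (funext h).symm]

/-- While loops with polynomially many iterations and polynomially bounded states. -/
lemma FP.while {init : γ → σ} {test : σ → Bool} {step : σ → σ} (hi : FP init) (ht : FP test)
    (hs : FP step) (n : γ → ℕ) (T B : Polynomial ℕ) (hn : ∀ c, n c ≤ T.eval (inputSize c))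
    (hlt : ∀ c, ∀ i < n c, test (step^[i] (init c)) = true)
    (hend : ∀ c, test (step^[n c] (init c)) = false)
    (hB : ∀ c, ∀ i ≤ n c, inputSize (step^[i] (init c)) ≤ B.eval (inputSize c)) :
    FP fun c => step^[n c] (init c) := by
  obtain ⟨e, r, hef, he⟩ := hi
  obtain ⟨t, p, htf, ht⟩ := ht
  obtain ⟨d, q, hdf, hd⟩ := hs
  refine ⟨.seq e (.while t d), r + (T * (p.comp B + q.comp B) + (p.comp B + B + 1)) + 1,
    ⟨hef, htf, hdf⟩, fun c => ?_⟩
  set S := B.eval (inputSize c) with hS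
  -- Induction on the number `m` of iterations still to come, since a derivation of a loop is built
  -- from its end.
  have key : ∀ m i, i + m = n c → ∃ r ≤ m * (p.eval S + q.eval S) + (p.eval S + S + 1),
      Eval (.while t d) (HasVal.enc (step^[i] (init c))) (HasVal.enc (step^[n c] (init c))) r := by
    intro m
    induction m with
    | zero =>
      intro i hi
      obtain rfl : i = n c := by omega
      obtain ⟨r, hr, he⟩ := ht (step^[n c] (init c))
      rw [hend] at he
      refine ⟨_, ?_, .while_false he rfl⟩
      have h1 := hB c (n c) le_rfl
      rw [← hS] at h1
      have h2 := eval_poly_mono p h1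
      unfold inputSize at *
      omega
    | succ m ih =>
      intro i hi
      obtain ⟨r, hr, he⟩ := ht (step^[i] (init c))
      rw [hlt c i (by omega)] at he
      obtain ⟨r', hr', he'⟩ := hd (step^[i] (init c))
      obtain ⟨r'', hr'', he''⟩ := ih (i + 1) (by omega)
      rw [Function.iterate_succ_apply'] at he''
      refine ⟨_, ?_, .while_true he rfl he' he''⟩
      have h1 := hB c i (by omega)
      rw [← hS] at h1
      have h2 := eval_poly_mono p h1
      have h3 := eval_poly_mono q h1
      rw [add_mul, one_mul]
      omega
  obtain ⟨a, ha, hae⟩ := he c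
  obtain ⟨b, hb, hbe⟩ := key (n c) 0 (by omega)
  refine ⟨_, ?_, .seq hae hbe⟩
  have h1 := Nat.mul_le_mul_right (p.eval S + q.eval S) (hn c)
  simp only [Polynomial.eval_add, Polynomial.eval_mul, Polynomial.eval_comp, Polynomial.eval_one,
    ← hS]
  omega

end PublicCoinZK

namespace PublicCoinZK

variable {α β γ δ σ : Type} [HasVal α] [HasVal β] [HasVal γ] [HasVal δ] [HasVal σ]

/-! ### Booleans, lists and unary numbers -/

/-- Natural numbers are written in unary. -/
instance : HasVal ℕ := ⟨fun n => HasVal.enc (List.replicate n true)⟩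

/-- Trees encode themselves, so that operations on encodings, such as serialization, can be treated
as functions in `FP`. -/
instance : HasVal Val := ⟨fun v => v⟩

lemma inputSize_bool (b : Bool) : inputSize b = 1 := rfl

lemma inputSize_nil : inputSize ([] : List α) = 1 := rfl

lemma inputSize_cons (a : α) (l : List α) :
    inputSize (a :: l) = inputSize a + inputSize l + 1 := rfl

lemma inputSize_bits (l : List Bool) : inputSize l = 2 * l.length + 1 := by
  induction l with
  | nil => rfl
  | cons b l ih => rw [inputSize_cons, inputSize_bool, ih, List.length_cons]; ring

lemma inputSize_nat (n : ℕ) : inputSize n = 2 * n + 1 := by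
  have := inputSize_bits (List.replicate n true)
  rwa [List.length_replicate] at this

lemma length_le_inputSize (l : List α) : l.length ≤ inputSize l := by
  induction l with
  | nil => simp
  | cons a l ih => rw [inputSize_cons, List.length_cons]; omega

lemma inputSize_append (l l' : List α) :
    inputSize (l ++ l') + 1 = inputSize l + inputSize l' := by
  induction l with
  | nil => simp [inputSize_nil]; omega
  | cons a l ih => rw [List.cons_append, inputSize_cons, inputSize_cons]; omega

lemma inputSize_reverse (l : List α) : inputSize l.reverse = inputSize l := by
  induction l with
  | nil => rfl
  | cons a l ih =>
    have := inputSize_append l.reverse [a]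
    rw [List.reverse_cons, inputSize_cons]
    rw [inputSize_cons, inputSize_nil] at this
    omega

lemma inputSize_take_le (n : ℕ) (l : List α) : inputSize (l.take n) ≤ inputSize l := by
  have h := inputSize_append (l.take n) (l.drop n)
  have := one_le_inputSize (l.drop n)
  rw [List.take_append_drop] at h
  omega

lemma inputSize_drop_le (n : ℕ) (l : List α) : inputSize (l.drop n) ≤ inputSize l := by
  have h := inputSize_append (l.take n) (l.drop n)
  have := one_le_inputSize (l.take n)
  rw [List.take_append_drop] at h
  omega

lemma inputSize_le_of_mem {a : α} {l : List α} (h : a ∈ l) : inputSize a ≤ inputSize l := by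
  induction l with
  | nil => simp at h
  | cons b l ih =>
    rw [inputSize_cons]
    rcases List.mem_cons.1 h with rfl | h
    · omega
    · have := ih h; omega

lemma inputSize_le_of_forall {l : List α} {M : ℕ} (h : ∀ a ∈ l, inputSize a ≤ M) :
    inputSize l ≤ l.length * (M + 1) + 1 := by
  induction l with
  | nil => simp [inputSize_nil]
  | cons a l ih =>
    have h1 := h a (by simp)
    have h2 := ih fun b hb => h b (by simp [hb])
    rw [inputSize_cons, List.length_cons, add_mul, one_mul]
    omega

lemma FP.not {f : α → Bool} (hf : FP f) : FP fun a => !f a :=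
  (hf.ite (.const false) (.const true)).congr fun a => by cases f a <;> rfl

lemma FP.and {f g : α → Bool} (hf : FP f) (hg : FP g) : FP fun a => f a && g a :=
  (hf.ite hg (.const false)).congr fun a => by cases f a <;> rfl

lemma FP.or {f g : α → Bool} (hf : FP f) (hg : FP g) : FP fun a => f a || g a :=
  (hf.ite (.const true) hg).congr fun a => by cases f a <;> rfl

lemma FP.cons {f : γ → α} {g : γ → List α} (hf : FP f) (hg : FP g) : FP fun c => f c :: g c :=
  (hf.pair hg).of_enc_eq (fun c => c) _ (fun _ => rfl) fun _ => rfl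

/-- Case distinction on a list. -/
def listCase {α β : Type} (l : List α) (b : β) (h : α → List α → β) : β :=
  match l with
  | [] => b
  | a :: l => h a l

/-- The empty list is a leaf and a nonempty list is a node, so `isNode` decides the case. Pairing
the input with the list then is already the encoding of the triple on which `h` is run. -/
lemma FP.listCase {f : γ → List α} {g : γ → β} {h : γ → α → List α → β} (hf : FP f) (hg : FP g)
    (hh : FP fun a : γ × α × List α => h a.1 a.2.1 a.2.2) :
    FP fun c => listCase (f c) (g c) (h c) := by
  obtain ⟨e, p, hef, he⟩ := hf
  obtain ⟨d, q, hdf, hd⟩ := hg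
  obtain ⟨k, r, hkf, hk⟩ := hh
  refine ⟨.ite (.seq e .isNode) (.seq (.pair .id e) k) d,
    2 * p + 2 * p + q + r.comp (.X + p + 1) + 4 * .X + 10, ⟨⟨hef, trivial⟩, ⟨⟨trivial, hef⟩, hkf⟩, hdf⟩,
    fun c => ?_⟩
  obtain ⟨s, hs, hse⟩ := he c
  have hsz := hse.size_le
  simp only [Polynomial.eval_add, Polynomial.eval_mul, Polynomial.eval_comp, Polynomial.eval_one,
    Polynomial.eval_X, Polynomial.eval_ofNat]
  have ht := Eval.seq hse (.isNode _)
  rcases hfc : f c with _ | ⟨a, l⟩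
  · obtain ⟨s', hs', hse'⟩ := hd c
    rw [hfc] at ht
    refine ⟨_, ?_, .ite_false ht rfl hse'⟩
    rw [hfc] at hsz
    unfold inputSize at *
    omega
  · obtain ⟨s', hs', hse'⟩ := hk (c, a, l)
    rw [hfc] at ht hse hsz
    have hp := Eval.seq (Eval.pair (.id _) hse) hse'
    refine ⟨_, ?_, .ite_true ht rfl hp⟩
    have : inputSize (c, a, l) ≤ inputSize c + p.eval (inputSize c) + 1 := by
      have : inputSize (c, a, l) = inputSize c + inputSize (a :: l) + 1 := rfl
      rw [this]
      unfold inputSize at *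
      omega
    have := eval_poly_mono r this
    unfold inputSize at *
    omega

lemma FP.isEmpty {f : γ → List α} (hf : FP f) : FP fun c => (f c).isEmpty :=
  (FP.listCase (h := fun _ _ _ => false) hf (.const true) (.const false)).congr fun c => by
    cases f c <;> rfl

lemma FP.tail {f : γ → List α} (hf : FP f) : FP fun c => (f c).tail :=
  (FP.listCase (h := fun _ _ l => l) hf (.const []) (FP.snd.comp FP.snd)).congr fun c => by
    cases f c <;> rfl

lemma FP.headD {f : γ → List α} {g : γ → α} (hf : FP f) (hg : FP g) :
    FP fun c => (f c).headD (g c) :=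
  (FP.listCase (h := fun _ a _ => a) hf hg (FP.fst.comp FP.snd)).congr fun c => by
    cases f c <;> rfl

lemma FP.foldl {l : γ → List α} {s : γ → σ} {g : γ → σ → α → σ} (hl : FP l) (hs : FP s)
    (hg : FP fun a : γ × σ × α => g a.1 a.2.1 a.2.2) (B : Polynomial ℕ)
    (hB : ∀ c l', l' <+: l c → inputSize (l'.foldl (g c) (s c)) ≤ B.eval (inputSize c)) :
    FP fun c => (l c).foldl (g c) (s c) := by
  -- The state of the loop carries the parameter `c` along, since the program has no other memory.
  let step : γ × σ × List α → γ × σ × List α := fun a =>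
    PublicCoinZK.listCase a.2.2 a fun b l => (a.1, g a.1 a.2.1 b, l)
  have hstep : FP step := by
    refine FP.listCase (h := fun (a : γ × σ × List α) b l => (a.1, g a.1 a.2.1 b, l))
      (FP.snd.comp FP.snd) FP.id ?_
    refine (FP.fst.comp FP.fst).pair (.pair ?_ (FP.snd.comp FP.snd))
    exact hg.comp (f := fun a : (γ × σ × List α) × α × List α => (a.1.1, a.1.2.1, a.2.1))
      ((FP.fst.comp FP.fst).pair
        ((FP.fst.comp (FP.snd.comp FP.fst)).pair (FP.fst.comp FP.snd)))
  have hiter : ∀ (c : γ) (s : σ) (l : List α) (i : ℕ),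
      step^[i] (c, s, l) = (c, (l.take i).foldl (g c) s, l.drop i) := by
    intro c s l i
    induction i generalizing s l with
    | zero => simp
    | succ i ih =>
      rcases l with _ | ⟨b, l⟩
      · have : step (c, s, []) = (c, s, []) := rfl
        rw [Function.iterate_succ_apply, this, ih]
        simp
      · have : step (c, s, b :: l) = (c, g c s b, l) := rfl
        rw [Function.iterate_succ_apply, this, ih]
        simp
  obtain ⟨p, hp⟩ := hl.size_le
  have hw : FP fun c => step^[(l c).length] (c, s c, l c) := by
    refine FP.while (test := fun a => !a.2.2.isEmpty) (FP.id.pair (hs.pair hl))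
      (FP.not (f := fun a : γ × σ × List α => a.2.2.isEmpty) (FP.snd.comp FP.snd).isEmpty) hstep (fun c => (l c).length) p (.X + B + p + 2)
      (fun c => (length_le_inputSize _).trans (hp c)) ?_ ?_ ?_
    · intro c i hi
      rw [hiter]
      simp only [Bool.not_eq_true', List.isEmpty_eq_false_iff, ne_eq, List.drop_eq_nil_iff]
      omega
    · intro c
      rw [hiter]
      simp
    · intro c i hi
      rw [hiter, inputSize_pair, inputSize_pair]
      have h1 := hB c _ (List.take_prefix i (l c))
      have h2 := (inputSize_drop_le i (l c)).trans (hp c)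
      simp only [Polynomial.eval_add, Polynomial.eval_X, Polynomial.eval_ofNat]
      omega
  refine ((FP.fst.comp FP.snd).comp hw).congr fun c => ?_
  rw [hiter]
  simp

lemma FP.reverse {l : γ → List α} (hl : FP l) : FP fun c => (l c).reverse := by
  obtain ⟨p, hp⟩ := hl.size_le
  refine (FP.foldl (g := fun _ s a => a :: s) hl (.const ([] : List α))
    ((FP.snd.comp FP.snd).cons (FP.fst.comp FP.snd)) p ?_).congr fun c => by simp
  rintro c l' ⟨m, hm⟩
  have : l'.foldl (fun s a => a :: s) [] = l'.reverse := by simp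
  rw [this, inputSize_reverse]
  have h := inputSize_append l' m
  have := one_le_inputSize m
  have := hp c
  rw [hm] at h
  omega

lemma FP.append {l l' : γ → List α} (hl : FP l) (hl' : FP l') : FP fun c => l c ++ l' c := by
  obtain ⟨p, hp⟩ := hl.size_le
  obtain ⟨q, hq⟩ := hl'.size_le
  refine (FP.foldl (g := fun _ s a => a :: s) hl.reverse hl'
    ((FP.snd.comp FP.snd).cons (FP.fst.comp FP.snd)) (p + q) ?_).congr fun c => by simp
  rintro c k ⟨m, hm⟩
  have : k.foldl (fun s a => a :: s) (l' c) = k.reverse ++ l' c := by simp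
  rw [this]
  have h := inputSize_append k m
  have h' := inputSize_append k.reverse (l' c)
  have := one_le_inputSize m
  have h1 := hp c
  have h2 := hq c
  rw [hm, inputSize_reverse] at h
  rw [inputSize_reverse] at h'
  simp only [Polynomial.eval_add]
  omega

lemma FP.map {l : γ → List α} {f : γ → α → β} (hl : FP l) (hf : FP fun a : γ × α => f a.1 a.2) :
    FP fun c => (l c).map (f c) := by
  obtain ⟨p, hp⟩ := hl.size_le
  obtain ⟨q, hq⟩ := hf.size_le
  have h := FP.foldl (g := fun c s a => f c a :: s) hl (.const ([] : List β))
    (FP.cons (hf.comp (FP.fst.pair (FP.snd.comp FP.snd))) (FP.fst.comp FP.snd))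
    (p * (q.comp (.X + p + 1) + 1) + 1) ?_
  · refine h.reverse.congr fun c => ?_
    simp
  · rintro c k hk
    have : k.foldl (fun s a => f c a :: s) [] = (k.map (f c)).reverse := by simp
    rw [this, inputSize_reverse]
    have hlen := hk.length_le
    refine (inputSize_le_of_forall (M := q.eval (inputSize c + p.eval (inputSize c) + 1)) ?_).trans
      ?_
    · intro b hb
      obtain ⟨a, ha, rfl⟩ := List.mem_map.1 hb
      refine (hq (c, a)).trans (eval_poly_mono q ?_)
      rw [inputSize_pair]
      have := (inputSize_le_of_mem (hk.subset ha)).trans (hp c)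
      omega
    · simp only [Polynomial.eval_add, Polynomial.eval_mul, Polynomial.eval_comp, Polynomial.eval_X,
        Polynomial.eval_one, List.length_map]
      gcongr
      exact hlen.trans ((length_le_inputSize _).trans (hp c))

lemma FP.replicate_true {n : γ → ℕ} (hn : FP n) : FP fun c => List.replicate (n c) true :=
  hn.of_enc_eq (fun c => c) _ (fun _ => rfl) fun _ => rfl

lemma FP.succ {n : γ → ℕ} (hn : FP n) : FP fun c => n c + 1 :=
  ((FP.const true).cons hn.replicate_true).of_enc_eq (fun c => c) _ (fun _ => rfl) fun _ => rfl

lemma FP.pred {n : γ → ℕ} (hn : FP n) : FP fun c => n c - 1 :=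
  hn.replicate_true.tail.of_enc_eq (fun c => c) _ (fun _ => rfl) fun c => by
    cases n c <;> rfl

lemma FP.length {l : γ → List α} (hl : FP l) : FP fun c => (l c).length :=
  (hl.map (f := fun _ _ => true) (.const true)).of_enc_eq (fun c => c) _ (fun _ => rfl) fun c => by
    rw [List.map_const']; rfl

/-- A unary number is a list, so a counted loop is a fold that ignores the list entries. -/
lemma FP.iterate {n : γ → ℕ} {s : γ → σ} {g : γ → σ → σ} (hn : FP n) (hs : FP s)
    (hg : FP fun a : γ × σ => g a.1 a.2) (B : Polynomial ℕ)
    (hB : ∀ c, ∀ i ≤ n c, inputSize ((g c)^[i] (s c)) ≤ B.eval (inputSize c)) :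
    FP fun c => (g c)^[n c] (s c) := by
  have hfold : ∀ c (l : List Bool) (s : σ), l.foldl (fun s _ => g c s) s = (g c)^[l.length] s := by
    intro c l
    induction l with
    | nil => intro s; rfl
    | cons a l ih => intro s; rw [List.foldl_cons, ih, List.length_cons, Function.iterate_succ_apply]
  refine (FP.foldl (g := fun c s _ => g c s) hn.replicate_true hs
    (hg.comp (FP.fst.pair (FP.fst.comp FP.snd))) B ?_).congr fun c => by
      rw [hfold, List.length_replicate]
  intro c l' hl'
  rw [hfold]
  exact hB c _ (by simpa using hl'.length_le)

lemma FP.drop {n : γ → ℕ} {l : γ → List α} (hn : FP n) (hl : FP l) :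
    FP fun c => (l c).drop (n c) := by
  have hiter : ∀ (l : List α) i, List.tail^[i] l = l.drop i := by
    intro l i
    induction i with
    | zero => rfl
    | succ i ih => rw [Function.iterate_succ_apply', ih, List.tail_drop]
  obtain ⟨p, hp⟩ := hl.size_le
  refine (FP.iterate (g := fun _ l => l.tail) hn hl FP.snd.tail p ?_).congr fun c => hiter _ _
  intro c i _
  exact (congrArg inputSize (hiter _ _)).le.trans ((inputSize_drop_le _ _).trans (hp c))

lemma FP.sub {m n : γ → ℕ} (hm : FP m) (hn : FP n) : FP fun c => m c - n c := by
  have hiter : ∀ (k : ℕ) i, (fun a => a - 1)^[i] k = k - i := by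
    intro k i
    induction i with
    | zero => rfl
    | succ i ih => rw [Function.iterate_succ_apply', ih]; omega
  obtain ⟨p, hp⟩ := hm.size_le
  refine (FP.iterate (g := fun _ a => a - 1) hn hm FP.snd.pred p ?_).congr fun c => hiter _ _
  intro c i _
  have := hp c
  rw [hiter, inputSize_nat]
  rw [inputSize_nat] at this
  omega

lemma FP.add {m n : γ → ℕ} (hm : FP m) (hn : FP n) : FP fun c => m c + n c :=
  (hm.replicate_true.append hn.replicate_true).of_enc_eq (fun c => c) _ (fun _ => rfl) fun c => by
    rw [List.replicate_append_replicate]; rfl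

lemma FP.mul {m n : γ → ℕ} (hm : FP m) (hn : FP n) : FP fun c => m c * n c := by
  have hiter : ∀ (k : ℕ) i, (fun a => a + k)^[i] 0 = i * k := by
    intro k i
    induction i with
    | zero => simp
    | succ i ih => rw [Function.iterate_succ_apply', ih]; ring
  obtain ⟨p, hp⟩ := hm.size_le
  obtain ⟨q, hq⟩ := hn.size_le
  refine (FP.iterate (g := fun c a => a + n c) hm (.const 0)
    (FP.snd.add (hn.comp FP.fst)) (2 * (p * q) + 1) ?_).congr fun c => hiter _ _
  intro c i hi
  have h1 := hp c
  have h2 := hq c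
  rw [inputSize_nat] at h1 h2
  have h3 : i * n c ≤ p.eval (inputSize c) * q.eval (inputSize c) :=
    Nat.mul_le_mul (by omega) (by omega)
  rw [hiter, inputSize_nat]
  simp only [Polynomial.eval_add, Polynomial.eval_mul, Polynomial.eval_ofNat, Polynomial.eval_one]
  omega

lemma FP.polyEval (p : Polynomial ℕ) {n : γ → ℕ} (hn : FP n) : FP fun c => p.eval (n c) := by
  have hpow : ∀ k : ℕ, FP fun c => n c ^ k := by
    intro k
    induction k with
    | zero => simpa using FP.const 1
    | succ k ih => simpa only [pow_succ] using ih.mul hn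
  induction p using Polynomial.induction_on' with
  | add p q hp hq => simpa only [Polynomial.eval_add] using hp.add hq
  | monomial k a => simpa only [Polynomial.eval_monomial] using (FP.const a).mul (hpow k)

lemma FP.lt {m n : γ → ℕ} (hm : FP m) (hn : FP n) : FP fun c => decide (m c < n c) :=
  (hn.sub hm).replicate_true.isEmpty.not.congr fun c => by
    simp only [List.isEmpty_replicate]
    by_cases h : m c < n c
    · have : n c - m c ≠ 0 := by omega
      simp [h, this]
    · have : n c - m c = 0 := by omega
      simp [h, this]

lemma FP.take {n : γ → ℕ} {l : γ → List α} (hn : FP n) (hl : FP l) :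
    FP fun c => (l c).take (n c) :=
  (FP.drop (hl.reverse.length.sub hn) hl.reverse).reverse.congr fun c => by
    rw [← List.take_reverse, List.reverse_reverse]

lemma FP.replicate {n : γ → ℕ} {a : γ → α} (hn : FP n) (ha : FP a) :
    FP fun c => List.replicate (n c) (a c) :=
  (hn.replicate_true.map (f := fun c _ => a c) (ha.comp FP.fst)).congr fun c => by
    rw [List.map_const', List.length_replicate]

lemma FP.getD {n : γ → ℕ} {l : γ → List α} {a : γ → α} (hn : FP n) (hl : FP l) (ha : FP a) :
    FP fun c => (l c).getD (n c) (a c) :=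
  (FP.headD (FP.drop hn hl) ha).congr fun c => by
    rw [List.headD_eq_head?_getD, List.head?_drop, List.getD_eq_getElem?_getD]

lemma FP.flatten_pairs {l : γ → List (Bool × Bool)} (hl : FP l) :
    FP fun c => (l c).flatMap fun b => [b.1, b.2] := by
  obtain ⟨p, hp⟩ := hl.size_le
  have hfold : ∀ (l : List (Bool × Bool)) (s : List Bool),
      l.foldl (fun s b => b.2 :: b.1 :: s) s = (l.flatMap fun b => [b.1, b.2]).reverse ++ s := by
    intro l
    induction l with
    | nil => intro s; rfl
    | cons b l ih => intro s; rw [List.foldl_cons, ih]; simp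
  have h := FP.foldl (g := fun _ s (b : Bool × Bool) => b.2 :: b.1 :: s) hl
    (.const ([] : List Bool)) (FP.cons (FP.snd.comp (FP.snd.comp FP.snd))
      (FP.cons (FP.fst.comp (FP.snd.comp FP.snd)) (FP.fst.comp FP.snd))) (4 * p + 1) ?_
  · refine h.reverse.congr fun c => ?_
    rw [hfold]
    simp
  · intro c k hk
    have h1 := hk.length_le
    have h2 := (length_le_inputSize _).trans (hp c)
    rw [hfold, inputSize_bits]
    simp only [Polynomial.eval_add, Polynomial.eval_mul, Polynomial.eval_ofNat,
      Polynomial.eval_one, List.append_nil, List.length_reverse, List.length_flatMap,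
      List.length_cons, List.length_nil, List.map_const', List.sum_replicate, smul_eq_mul]
    omega

end PublicCoinZK

namespace PublicCoinZK

variable {α β γ δ σ : Type} [HasVal α] [HasVal β] [HasVal γ] [HasVal δ] [HasVal σ]

/-! ### Serialization of trees -/

namespace Val

/-- The vertices in depth-first order: `(true, true)` for a node and `(false, b)` for a leaf. -/
def vertices : Val → List (Bool × Bool)
  | atom b => [(false, b)]
  | node l r => (true, true) :: (l.vertices ++ r.vertices)

/-- Serialization of a tree as a bit string. -/
def ser (v : Val) : List Bool := v.vertices.flatMap fun b => [b.1, b.2]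

lemma length_vertices (v : Val) : v.vertices.length = v.size := by
  induction v with
  | atom b => rfl
  | node l r hl hr => simp [vertices, size, hl, hr]

lemma length_ser (v : Val) : v.ser.length = 2 * v.size := by
  rw [ser, List.length_flatMap, ← length_vertices]
  simp [mul_comm]

/-- The serialization is prefix-free: the first bit of each pair tells whether a subtree ends.
Padding it to a fixed length therefore loses no information. -/
lemma ser_append_inj {v w : Val} {a b : List Bool} (h : v.ser ++ a = w.ser ++ b) :
    v = w ∧ a = b := by
  induction v generalizing w a b with
  | atom c =>
    cases w with
    | atom d => simpa [ser, vertices] using h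
    | node l r => simp [ser, vertices] at h
  | node l r hl hr =>
    cases w with
    | atom d => simp [ser, vertices] at h
    | node l' r' =>
      have e : ∀ l r : Val, (node l r).ser = true :: true :: (l.ser ++ r.ser) := fun l r => by
        simp [ser, vertices]
      simp only [e, List.cons_append, List.cons.injEq, true_and, List.append_assoc] at h
      obtain ⟨rfl, h'⟩ := hl h
      obtain ⟨rfl, h''⟩ := hr h'
      exact ⟨rfl, h''⟩

/-- One step of the depth-first traversal, with a stack of trees that are still to be visited and
the list of visited vertices in reverse order. -/
def visit (s : List Val × List (Bool × Bool)) : List Val × List (Bool × Bool) :=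
  listCase s.1 s fun v st =>
    if v.isNode = true then (v.fst :: v.snd :: st, (true, true) :: s.2)
    else (st, (false, v.isTrue) :: s.2)

lemma fp_visit : FP visit := by
  have hfst : FP Val.fst := ⟨.fst, .X + 1, trivial, fun v => ⟨_, by simp [inputSize, HasVal.enc], .fst v⟩⟩
  have hsnd : FP Val.snd := ⟨.snd, .X + 1, trivial, fun v => ⟨_, by simp [inputSize, HasVal.enc], .snd v⟩⟩
  have hnode : FP Val.isNode :=
    ⟨.isNode, .X + 1, trivial, fun v => ⟨_, by simp [inputSize, HasVal.enc], .isNode v⟩⟩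
  have htrue : FP Val.isTrue := by
    refine ⟨.ite .id (.const true) (.const false), 3 * .X + 3, ⟨trivial, trivial, trivial⟩,
      fun v => ?_⟩
    refine ⟨(v.size + 1) + (v.size + 1) + v.size + 1, ?_, ?_⟩
    · simp [inputSize, HasVal.enc]; omega
    · rcases hv : v.isTrue with _ | _
      · exact .ite_false (.id v) hv (.const _ _)
      · exact .ite_true (.id v) hv (.const _ _)
  have hv : FP fun a : (List Val × List (Bool × Bool)) × Val × List Val => a.2.1 :=
    FP.fst.comp FP.snd
  have hst : FP fun a : (List Val × List (Bool × Bool)) × Val × List Val => a.2.2 :=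
    FP.snd.comp FP.snd
  have hout : FP fun a : (List Val × List (Bool × Bool)) × Val × List Val => a.1.2 :=
    FP.snd.comp FP.fst
  refine FP.listCase (h := fun (s : List Val × List (Bool × Bool)) v st =>
    if v.isNode = true then (v.fst :: v.snd :: st, (true, true) :: s.2)
    else (st, (false, v.isTrue) :: s.2)) FP.fst FP.id ?_
  exact (hnode.comp hv).ite
    (((hfst.comp hv).cons ((hsnd.comp hv).cons hst)).pair ((FP.const _).cons hout))
    (hst.pair (((FP.const false).pair (htrue.comp hv)).cons hout))

lemma visit_iterate (v : Val) (st : List Val) (out : List (Bool × Bool)) :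
    visit^[v.size] (v :: st, out) = (st, v.vertices.reverse ++ out) := by
  induction v generalizing st out with
  | atom b => rfl
  | node l r hl hr =>
    have h : visit (node l r :: st, out) = (l :: r :: st, (true, true) :: out) := rfl
    rw [size, Function.iterate_succ_apply, h, add_comm, Function.iterate_add_apply, hl, hr]
    simp [vertices]

/-- Each step moves exactly one vertex from the stack to the output. This shows both that the stack
becomes empty at the right time and that the state stays linear in the tree. -/
lemma visit_invariant (v : Val) (i : ℕ) (hi : i ≤ v.size) :
    ((visit^[i] ([v], [])).1.map size).sum + i = v.size ∧
      (visit^[i] ([v], [])).2.length = i := by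
  induction i with
  | zero => simp
  | succ i ih =>
    obtain ⟨h1, h2⟩ := ih (by omega)
    rw [Function.iterate_succ_apply']
    rcases hs : visit^[i] ([v], []) with ⟨_ | ⟨w, st⟩, out⟩
    · rw [hs] at h1
      simp at h1
      omega
    · rw [hs] at h1 h2
      simp only [List.map_cons, List.sum_cons] at h1 h2
      cases w with
      | atom b =>
        simp only [visit, listCase, isNode, Bool.false_eq_true, if_false, List.length_cons]
        simp only [size] at h1
        omega
      | node l r =>
        simp only [visit, listCase, isNode, if_true, List.length_cons, List.map_cons,
          List.sum_cons, fst, snd]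
        simp only [size] at h1
        omega

lemma fp_vertices : FP Val.vertices := by
  have key : FP fun v : Val => visit^[v.size] ([v], []) := by
    refine FP.while (test := fun s => !s.1.isEmpty) ((FP.id.cons (.const [])).pair (.const []))
      (FP.not (f := fun s : List Val × List (Bool × Bool) => s.1.isEmpty) FP.fst.isEmpty)
      fp_visit (fun v => v.size) .X (6 * .X + 3) (fun v => by simp [inputSize, HasVal.enc]) ?_ ?_ ?_
    · intro v i hi
      obtain ⟨h, -⟩ := visit_invariant v i hi.le
      rcases hs : (visit^[i] ([v], [])).1 with _ | ⟨w, st⟩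
      · rw [hs] at h
        simp at h
        omega
      · simp
    · intro v
      rw [visit_iterate]
      rfl
    · intro v i hi
      obtain ⟨h1, h2⟩ := visit_invariant v i hi
      rcases hx : visit^[i] ([v], []) with ⟨st, out⟩
      rw [hx] at h1 h2
      change (st.map size).sum + i = v.size at h1
      change out.length = i at h2
      have hst : inputSize st ≤ 2 * (st.map size).sum + 1 := by
        clear hx h1 h2 hi
        induction st with
        | nil => rfl
        | cons w st ih =>
          have : inputSize w = w.size := rfl
          have := w.one_le_size
          rw [inputSize_cons, List.map_cons, List.sum_cons]
          omega
      have hout : inputSize out ≤ out.length * (3 + 1) + 1 :=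
        inputSize_le_of_forall fun a _ => le_rfl
      rw [inputSize_pair]
      simp only [Polynomial.eval_add, Polynomial.eval_mul, Polynomial.eval_X,
        Polynomial.eval_ofNat]
      have : inputSize v = v.size := rfl
      omega
  refine (FP.snd.comp key).reverse.congr fun v => ?_
  rw [visit_iterate]
  simp

end Val

lemma FP.enc {f : α → β} (hf : FP f) : FP fun a => HasVal.enc (f a) :=
  hf.of_enc_eq (fun c => c) _ (fun _ => rfl) fun _ => rfl

/-- Sizes must be computable because samplers cut their coins at polynomials in the input size. -/
lemma FP.inputSize {f : α → β} (hf : FP f) : FP fun a => inputSize (f a) :=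
  (Val.fp_vertices.comp hf.enc).length.congr fun _ => Val.length_vertices _

lemma FP.ser {f : α → Val} (hf : FP f) : FP fun a => (f a).ser :=
  (Val.fp_vertices.comp hf).flatten_pairs

/-- Truncate or extend a string to length `m`. -/
def pad (m : ℕ) (l : List Bool) : List Bool := (l ++ List.replicate m false).take m

lemma length_pad (m : ℕ) (l : List Bool) : (pad m l).length = m := by
  simp [pad]

lemma pad_of_length_le {m : ℕ} {l : List Bool} (h : l.length ≤ m) :
    pad m l = l ++ List.replicate (m - l.length) false := by
  rw [pad, List.take_append, List.take_of_length_le h, List.take_replicate]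
  congr 2; omega

lemma FP.pad {m : γ → ℕ} {l : γ → List Bool} (hm : FP m) (hl : FP l) :
    FP fun c => pad (m c) (l c) :=
  FP.take hm (hl.append (hm.replicate (.const false)))

/-! ### Uniform strings -/

lemma unif_apply (n : ℕ) (l : List Bool) :
    unif n l = if l.length = n then ((2 : ENNReal) ^ n)⁻¹ else 0 := by
  rw [unif, PMF.map_apply]
  split_ifs with h
  · subst h
    rw [tsum_eq_single l.get]
    · simp [PMF.uniformOfFintype_apply]
    · intro f hf
      rw [if_neg]
      rintro h
      apply hf
      have := List.ofFn_injective (h.symm.trans (List.ofFn_get l).symm)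
      exact this
  · rw [ENNReal.tsum_eq_zero]
    intro f
    rw [if_neg]
    rintro rfl
    simp at h

lemma mem_support_unif {n : ℕ} {l : List Bool} : l ∈ (unif n).support ↔ l.length = n := by
  rw [PMF.mem_support_iff, unif_apply]
  by_cases h : l.length = n <;> simp [h]

lemma pmf_bind_congr {α β : Type} {p : PMF α} {f g : α → PMF β}
    (h : ∀ a ∈ p.support, f a = g a) : p.bind f = p.bind g := by
  ext b
  rw [PMF.bind_apply, PMF.bind_apply]
  refine tsum_congr fun a => ?_
  by_cases ha : a ∈ p.support
  · rw [h a ha]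
  · rw [PMF.mem_support_iff, not_not] at ha
    simp [ha]

lemma pmf_map_congr {α β : Type} {p : PMF α} {f g : α → β}
    (h : ∀ a ∈ p.support, f a = g a) : p.map f = p.map g :=
  pmf_bind_congr fun a ha => by simp [h a ha]

lemma unif_add (a b : ℕ) :
    unif (a + b) = (unif a).bind fun u => (unif b).map fun v => u ++ v := by
  ext l
  rw [PMF.bind_apply, tsum_eq_single (l.take a)]
  · rw [PMF.map_apply, tsum_eq_single (l.drop a)]
    · simp only [unif_apply, List.take_append_drop, if_true, List.length_take, List.length_drop]
      by_cases h : l.length = a + b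
      · rw [if_pos h, if_pos (by omega), if_pos (by omega), pow_add, ENNReal.mul_inv] <;> simp
      · rw [if_neg h]
        by_cases h' : min a l.length = a
        · rw [if_neg (by omega : ¬ (l.length - a = b)), mul_zero]
        · rw [if_neg h', zero_mul]
    · intro v hv
      split_ifs with h
      · exfalso
        apply hv
        exact (List.append_cancel_left ((List.take_append_drop a l).trans h)).symm
      · rfl
  · intro u hu
    rw [mul_eq_zero, or_iff_not_imp_left]
    intro h
    have hlen : u.length = a := mem_support_unif.1 ((PMF.mem_support_iff _ _).2 h)
    rw [PMF.map_apply, ENNReal.tsum_eq_zero]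
    intro v
    rw [if_neg]
    rintro rfl
    apply hu
    rw [← hlen]
    simp

lemma unif_map_take {a m : ℕ} (h : a ≤ m) : (unif m).map (List.take a) = unif a := by
  obtain ⟨b, rfl⟩ := Nat.exists_eq_add_of_le h
  rw [unif_add, PMF.map_bind]
  have : ∀ u ∈ (unif a).support,
      ((unif b).map fun v => u ++ v).map (List.take a) = PMF.pure u := by
    intro u hu
    rw [mem_support_unif] at hu
    rw [PMF.map_comp, show (List.take a ∘ fun v => u ++ v) = Function.const _ u from
      funext fun v => by simp [← hu], PMF.map_const]
  rw [pmf_bind_congr this, PMF.bind_pure]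

/-! ### Closure properties of probabilistic polynomial time -/

/-- The coins of a sampler may be taken from any sufficiently long uniform string. -/
lemma ppt_iff {A : α → PMF β} : PPT A ↔ ∃ (h : α × List Bool → β) (q : Polynomial ℕ), FP h ∧
    ∀ a : α, ∀ m ≥ q.eval (inputSize a), A a = (unif m).map fun ρ => h (a, ρ) := by
  constructor
  · rintro ⟨h, q, hh, hA⟩
    refine ⟨fun a => h (a.1, a.2.take (q.eval (inputSize a.1))), q, ?_, fun a m hm => ?_⟩
    · exact (fp_iff.2 hh).comp (FP.fst.pair ((FP.fst.inputSize.polyEval q).take FP.snd))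
    · rw [hA, ← unif_map_take hm, PMF.map_comp]
      rfl
  · rintro ⟨h, q, hh, hA⟩
    exact ⟨h, q, fp_iff.1 hh, fun a => hA a _ le_rfl⟩

lemma PPT.of_fp {f : α → β} (hf : FP f) : PPT fun a => PMF.pure (f a) :=
  ppt_iff.2 ⟨fun a => f a.1, 0, hf.comp FP.fst, fun _ _ _ => (PMF.map_const _ _).symm⟩

lemma PPT.unif {n : α → ℕ} (hn : FP n) : PPT fun a => unif (n a) := by
  obtain ⟨p, hp⟩ := hn.size_le
  refine ppt_iff.2 ⟨fun a => a.2.take (n a.1), p, (hn.comp FP.fst).take FP.snd, fun a m hm => ?_⟩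
  have := hp a
  rw [inputSize_nat] at this
  exact (unif_map_take (by omega)).symm

lemma PPT.comp {A : β → PMF γ} {f : α → β} (hA : PPT A) (hf : FP f) : PPT fun a => A (f a) := by
  obtain ⟨h, q, hh, hA⟩ := ppt_iff.1 hA
  obtain ⟨p, hp⟩ := hf.size_le
  refine ppt_iff.2 ⟨fun a => h (f a.1, a.2), q.comp p, hh.comp ((hf.comp FP.fst).pair FP.snd),
    fun a m hm => hA _ _ ?_⟩
  rw [Polynomial.eval_comp] at hm
  exact (eval_poly_mono q (hp a)).trans hm

/-- The coins are cut into a block for `A` and a remainder for `B`. How many coins `B` needs depends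
on the output of `A`, whose size is bounded by `p`; surplus coins are harmless by `ppt_iff`. -/
lemma PPT.bind {A : α → PMF β} {B : α → β → PMF γ} (hA : PPT A)
    (hB : PPT fun a : α × β => B a.1 a.2) : PPT fun a => (A a).bind (B a) := by
  obtain ⟨h, q, hh, hA⟩ := ppt_iff.1 hA
  obtain ⟨h', q', hh', hB⟩ := ppt_iff.1 hB
  obtain ⟨p, hp⟩ := hh.size_le
  have hq : FP fun a : α × List Bool => q.eval (inputSize a.1) := FP.fst.inputSize.polyEval q
  refine ppt_iff.2 ⟨fun a => h' ((a.1, h (a.1, a.2.take (q.eval (inputSize a.1)))),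
    a.2.drop (q.eval (inputSize a.1))), q + q'.comp (.X + p.comp (.X + 2 * q + 2) + 1),
    hh'.comp ((FP.fst.pair (hh.comp (FP.fst.pair (hq.take FP.snd)))).pair (hq.drop FP.snd)),
    fun a m hm => ?_⟩
  simp only [Polynomial.eval_add, Polynomial.eval_comp, Polynomial.eval_X, Polynomial.eval_one,
    Polynomial.eval_mul, Polynomial.eval_ofNat] at hm
  set k := q.eval (inputSize a) with hk
  obtain ⟨m', rfl⟩ := Nat.exists_eq_add_of_le ((Nat.le_add_right _ _).trans hm)
  rw [unif_add, PMF.map_bind, hA a k le_rfl, PMF.bind_map]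
  refine pmf_bind_congr fun u hu => ?_
  rw [mem_support_unif] at hu
  rw [PMF.map_comp, Function.comp_apply, hB (a, h (a, u)) m']
  · congr 1
    funext v
    simp only [Function.comp_apply]
    rw [← hk, ← hu, List.take_left, List.drop_left]
  · have h1 := hp (a, u)
    have h2 : inputSize (a, u) = inputSize a + 2 * k + 2 := by
      rw [inputSize_pair, inputSize_bits, hu]; ring
    rw [h2] at h1
    refine (eval_poly_mono q' ?_).trans (Nat.le_of_add_le_add_left hm)
    rw [inputSize_pair]
    omega

lemma PPT.map {A : α → PMF β} {f : α → β → γ} (hA : PPT A) (hf : FP fun a : α × β => f a.1 a.2) :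
    PPT fun a => (A a).map (f a) :=
  hA.bind (B := fun a b => PMF.pure (f a b)) (.of_fp hf)

/-- Iteration of a randomized step. -/
noncomputable def iterK {σ : Type} (K : σ → PMF σ) : ℕ → σ → PMF σ
  | 0, s => PMF.pure s
  | n + 1, s => (K s).bind (iterK K n)

/-- Every step uses up a fresh block of the same length `Q`, so the blocks are independent. The
length has to suffice on reachable states only. -/
lemma iterK_eq_unif {K : σ → PMF σ} {h : σ × List Bool → σ} {q : Polynomial ℕ}
    (hK : ∀ a m, q.eval (inputSize a) ≤ m → K a = (PublicCoinZK.unif m).map fun ρ => h (a, ρ))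
    (Q n : ℕ) (s : σ)
    (hB : ∀ i < n, ∀ s' ∈ (iterK K i s).support, q.eval (inputSize s') ≤ Q) :
    (PublicCoinZK.unif (n * Q)).map (fun ρ =>
      ((fun a : σ × List Bool => (h (a.1, a.2.take Q), a.2.drop Q))^[n] (s, ρ)).1) =
      iterK K n s := by
  induction n generalizing s with
  | zero =>
    exact PMF.map_const _ _
  | succ n ih =>
    have h0 := hB 0 (by omega) s (by simp [iterK])
    rw [iterK, hK s Q h0, PMF.bind_map, show (n + 1) * Q = Q + n * Q by ring, unif_add,
      PMF.map_bind]
    refine pmf_bind_congr fun u hu => ?_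
    have hu' := mem_support_unif.1 hu
    rw [PMF.map_comp, Function.comp_apply, ← ih (h (s, u))]
    · congr 1
      funext v
      simp only [Function.comp_apply, Function.iterate_succ_apply]
      simp [← hu']
    · intro i hi s' hs'
      refine hB (i + 1) (by omega) s' ?_
      rw [iterK, PMF.mem_support_bind_iff]
      refine ⟨h (s, u), ?_, hs'⟩
      rw [hK s Q h0, PMF.mem_support_map_iff]
      exact ⟨u, hu, rfl⟩

lemma PPT.iterate {K : σ → PMF σ} {n : γ → ℕ} {s : γ → σ} (hK : PPT K) (hn : FP n) (hs : FP s)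
    (B : Polynomial ℕ)
    (hB : ∀ c, ∀ i ≤ n c, ∀ s' ∈ (iterK K i (s c)).support, inputSize s' ≤ B.eval (inputSize c)) :
    PPT fun c => iterK K (n c) (s c) := by
  obtain ⟨h, q, hh, hK⟩ := ppt_iff.1 hK
  obtain ⟨p, hp⟩ := hn.size_le
  have hQ : FP fun c : γ => q.eval (B.eval (inputSize c)) :=
    ((FP.id.inputSize).polyEval B).polyEval q
  set Q : γ → ℕ := fun c => q.eval (B.eval (inputSize c)) with hQdef
  have hq : ∀ c, ∀ i ≤ n c, ∀ s' ∈ (iterK K i (s c)).support, q.eval (inputSize s') ≤ Q c :=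
    fun c i hi s' hs' => eval_poly_mono q (hB c i hi s' hs')
  let step : γ × List Bool → σ × List Bool → σ × List Bool :=
    fun c a => (h (a.1, a.2.take (Q c.1)), a.2.drop (Q c.1))
  -- `FP.iterate` wants size bounds for every coin string, while `hB` speaks of reachable states
  -- only. Padding to exactly the required length makes every state of the loop reachable.
  let init : γ × List Bool → σ × List Bool := fun c => (s c.1, pad (n c.1 * Q c.1) c.2)
  have hstep : FP fun a : (γ × List Bool) × σ × List Bool => step a.1 a.2 := by
    have h1 : FP fun a : (γ × List Bool) × σ × List Bool => Q a.1.1 :=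
      hQ.comp (FP.fst.comp FP.fst)
    exact (hh.comp ((FP.fst.comp FP.snd).pair (h1.take (FP.snd.comp FP.snd)))).pair
      (h1.drop (FP.snd.comp FP.snd))
  have hinit : FP init :=
    (hs.comp FP.fst).pair (((hn.mul hQ).comp FP.fst).pad FP.snd)
  have hiter : FP fun c => (step c)^[n c.1] (init c) := by
    refine FP.iterate (hn.comp FP.fst) hinit hstep
      (B + 2 * (p * q.comp B) + 2) fun c i hi => ?_
    have hlen : ((step c)^[i] (init c)).2.length = n c.1 * Q c.1 - i * Q c.1 := by
      clear hi
      induction i with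
      | zero => simp [init, length_pad]
      | succ i ih =>
        rw [Function.iterate_succ_apply']
        simp only [step, List.length_drop, ih, add_mul, one_mul]
        omega
    have hfst : ((step c)^[i] (init c)).1 ∈ (iterK K i (s c.1)).support := by
      rw [← iterK_eq_unif hK (Q c.1) i (s c.1) fun j hj => hq c.1 j (by omega),
        PMF.mem_support_map_iff]
      have hle : i * Q c.1 ≤ n c.1 * Q c.1 := Nat.mul_le_mul_right _ hi
      refine ⟨(pad (n c.1 * Q c.1) c.2).take (i * Q c.1), mem_support_unif.2 ?_, ?_⟩
      · rw [List.length_take, length_pad]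
        omega
      -- The first `i` steps look at the first `i` blocks only.
      · have aux : ∀ (i : ℕ) (s : σ) (ρ : List Bool), i * Q c.1 ≤ ρ.length →
            ((step c)^[i] (s, ρ.take (i * Q c.1))).1 = ((step c)^[i] (s, ρ)).1 := by
          intro i
          induction i with
          | zero => intro s ρ _; rfl
          | succ i ih =>
            intro s ρ hρ
            rw [add_mul, one_mul] at hρ ⊢
            rw [Function.iterate_succ_apply, Function.iterate_succ_apply]
            simp only [step]
            rw [List.take_take, min_eq_left (by omega), List.drop_take, Nat.add_sub_cancel]
            exact ih _ _ (by rw [List.length_drop]; omega)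
        exact aux i _ _ (by rw [length_pad]; exact hle)
    have h1 := hB c.1 i hi _ hfst
    have h2 := hp c.1
    rw [inputSize_nat] at h2
    have h3 : n c.1 * Q c.1 ≤ p.eval (inputSize c.1) * Q c.1 := Nat.mul_le_mul_right _ (by omega)
    have h4 : inputSize c.1 ≤ inputSize c := by rw [inputSize_pair]; omega
    rcases hx : (step c)^[i] (init c) with ⟨a, b⟩
    rw [hx] at hlen h1
    change b.length = _ at hlen
    change inputSize a ≤ _ at h1
    rw [inputSize_pair, inputSize_bits]
    calc _ ≤ B.eval (inputSize c.1) + 2 * (p.eval (inputSize c.1) * Q c.1) + 2 := by omega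
      _ = (B + 2 * (p * q.comp B) + 2).eval (inputSize c.1) := by
        simp [hQdef, Polynomial.eval_comp]
      _ ≤ _ := eval_poly_mono _ h4
  refine ppt_iff.2 ⟨fun c => ((step c)^[n c.1] (init c)).1, p * q.comp B, FP.fst.comp hiter,
    fun c m hm => ?_⟩
  have h2 := hp c
  rw [inputSize_nat] at h2
  have h3 : n c * Q c ≤ p.eval (inputSize c) * Q c := Nat.mul_le_mul_right _ (by omega)
  rw [Polynomial.eval_mul, Polynomial.eval_comp] at hm
  have hm : n c * Q c ≤ m := h3.trans hm
  rw [← iterK_eq_unif hK (Q c) (n c) (s c) fun j hj => hq c j hj.le, ← unif_map_take hm,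
    PMF.map_comp]
  refine pmf_map_congr fun ρ hρ => ?_
  rw [mem_support_unif] at hρ
  simp only [Function.comp_apply, step, init]
  rw [pad, List.take_append_of_le_length (by omega)]

end PublicCoinZK

namespace PublicCoinZK

variable {α β γ δ σ : Type} [HasVal α] [HasVal β] [HasVal γ] [HasVal δ] [HasVal σ]

/-! ### Oracle programs that query the oracle in a loop -/

lemma toBits_enc (l : List Bool) : (HasVal.enc l : Val).toBits = l := by
  induction l with
  | nil => rfl
  | cons b l ih =>
    change b :: (HasVal.enc l : Val).toBits = _
    rw [ih]

/-- One oracle query: `query` computes a bound on the length of the answer and the query, and `upd`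
computes the new state from the old state and the truncated answer. -/
noncomputable def oracleStep {σ : Type} (query : σ → List Bool × List Bool × List Bool)
    (upd : σ × List Bool → σ) (O : Oracle PMF) (s : σ) : PMF σ :=
  (O (query s).2).map fun a => upd (s, a.take (query s).1.length)

/-- The program and its time bound are fixed before the oracle. The bound holds for every oracle
because only the truncated answer enters the computation. -/
lemma exists_code_oracleStep {query : σ → List Bool × List Bool × List Bool}
    {upd : σ × List Bool → σ} (hq : FP query) (hu : FP upd) :
    ∃ (c : Code) (p : Polynomial ℕ) (st : σ → List Bool → ℕ),
      (∀ s a, a.length ≤ (query s).1.length → st s a ≤ p.eval (inputSize s)) ∧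
      ∀ (O : Oracle PMF) (N : ℕ) (s : σ), p.eval (inputSize s) ≤ N →
        c.run O N (HasVal.enc s) = (O (query s).2).map fun a =>
          (HasVal.enc (upd (s, a.take (query s).1.length)), st s (a.take (query s).1.length)) := by
  obtain ⟨cq, pq, -, hq⟩ := hq
  obtain ⟨cu, pu, -, hu⟩ := hu
  choose sq hsq heq using hq
  choose su hsu heu using hu
  let p : Polynomial ℕ := 3 * pq + 2 * .X + 10 + pu.comp (.X + pq + 1)
  let ans : List Bool → ℕ := fun a => (HasVal.enc a : Val).size
  let st : σ → List Bool → ℕ := fun s a =>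
    (inputSize s + 1) + (sq s + (inputSize (query s) + ans a + 1) + 1) + inputSize s + 1 +
      su (s, a) + 1
  have hst : ∀ s a, a.length ≤ (query s).1.length →
      st s a ≤ p.eval (inputSize s) := by
    intro s a ha
    have h1 := hsq s
    have h2 := (heq s).size_le
    have h3 : ans a = 2 * a.length + 1 := inputSize_bits a
    have h4 : inputSize (query s) = inputSize (query s).1 + inputSize (query s).2 + 1 := rfl
    rw [inputSize_bits] at h4
    have h5 : inputSize (s, a) ≤ inputSize s + pq.eval (inputSize s) + 1 := by
      rw [inputSize_pair, inputSize_bits]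
      unfold inputSize at *
      omega
    have h6 := (hsu (s, a)).trans (eval_poly_mono pu h5)
    have h7 : inputSize (query s) ≤ sq s := h2
    simp only [p, st, Polynomial.eval_add, Polynomial.eval_mul, Polynomial.eval_comp,
      Polynomial.eval_X, Polynomial.eval_one, Polynomial.eval_ofNat]
    omega
  refine ⟨.seq (.pair .id (.seq cq .ask)) cu, p, st, hst, fun O N s hN => ?_⟩
  have hq' : cq.run O N (HasVal.enc s) = PMF.pure (HasVal.enc (query s), sq s) := by
    refine (heq s).run O ?_
    have := hst s [] (by simp)
    simp only [st] at this
    omega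
  have hask : Code.ask.run O N (HasVal.enc (query s)) = (O (query s).2).bind fun a =>
      PMF.pure (HasVal.enc (a.take (query s).1.length), inputSize (query s) +
        ans (a.take (query s).1.length) + 1) := by
    have e1 : (HasVal.enc (query s) : Val).fst.toBits = (query s).1 := toBits_enc _
    have e2 : (HasVal.enc (query s) : Val).snd.fst.toBits = (query s).2.1 := toBits_enc _
    have e3 : (HasVal.enc (query s) : Val).snd.snd.toBits = (query s).2.2 := toBits_enc _
    rw [Code.run, e1, e2, e3]
    rfl
  change (((PMF.pure (HasVal.enc s, inputSize s + 1)).bind fun a =>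
    ((cq.run O N (HasVal.enc s)).bind fun b => (Code.ask.run O N b.1).bind fun d =>
      PMF.pure (d.1, b.2 + d.2 + 1)).bind fun b => PMF.pure (Val.node a.1 b.1,
        a.2 + b.2 + inputSize s + 1)).bind fun a => (cu.run O N a.1).bind fun b =>
          PMF.pure (b.1, a.2 + b.2 + 1)) = _
  rw [hq']
  simp only [PMF.pure_bind, hask, PMF.bind_bind]
  refine pmf_bind_congr fun a _ => ?_
  set a' := a.take (query s).1.length with ha'
  have hu' : cu.run O N (Val.node (HasVal.enc s) (HasVal.enc a')) =
      PMF.pure (HasVal.enc (upd (s, a')), su (s, a')) := by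
    refine (heu (s, a')).run O ?_
    have := hst s a' (by rw [ha', List.length_take]; omega)
    simp only [st] at this
    omega
  rw [hu', PMF.pure_bind]
  rfl

/-- The invariant `Inv i s` of an oracle loop in a state `s` in which `i` iterations are left. -/
structure LoopInvariant (test : σ → Bool) (query : σ → List Bool × List Bool × List Bool)
    (upd : σ × List Bool → σ) (S : ℕ) (Inv : ℕ → σ → Prop) : Prop where
  size : ∀ i s, Inv i s → inputSize s ≤ S
  finished : ∀ s, Inv 0 s → test s = false
  running : ∀ i s, Inv (i + 1) s → test s = true
  next : ∀ i s, Inv (i + 1) s → ∀ a : List Bool, a.length ≤ (query s).1.length → Inv i (upd (s, a))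

lemma LoopInvariant.iterK {test : σ → Bool} {query : σ → List Bool × List Bool × List Bool}
    {upd : σ × List Bool → σ} {S : ℕ} {Inv : ℕ → σ → Prop}
    (hI : LoopInvariant test query upd S Inv) (O : Oracle PMF) (i j : ℕ) (s : σ)
    (hs : Inv (i + j) s) : ∀ s' ∈ (iterK (oracleStep query upd O) i s).support, Inv j s' := by
  induction i generalizing s with
  | zero =>
    intro s' hs'
    rw [PublicCoinZK.iterK, PMF.mem_support_pure_iff] at hs'
    rwa [hs', ← zero_add j]
  | succ i ih =>
    intro s' hs'
    rw [PublicCoinZK.iterK, PMF.mem_support_bind_iff] at hs'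
    obtain ⟨u, hu, hs'⟩ := hs'
    rw [oracleStep, PMF.mem_support_map_iff] at hu
    obtain ⟨a, -, rfl⟩ := hu
    refine ih _ ?_ s' hs'
    exact hI.next _ _ (by rwa [add_right_comm] at hs) _ (by rw [List.length_take]; omega)

/-- Values and step counts are treated separately: the values have the law of `iterK`, while the
step bound must hold for every outcome. The fuel strictly exceeds the number of rounds because the
final failing test also uses up a unit. -/
lemma whileLoop_oracleStep {test : σ → Bool} {query : σ → List Bool × List Bool × List Bool}
    {upd : σ × List Bool → σ} {S : ℕ} {Inv : ℕ → σ → Prop}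
    (hI : LoopInvariant test query upd S Inv) {t c : Code} {pt pc : Polynomial ℕ}
    {st : σ → List Bool → ℕ}
    (ht : ∀ s, ∃ k ≤ pt.eval (inputSize s), Eval t (HasVal.enc s) (HasVal.enc (test s)) k)
    (hst : ∀ s a, a.length ≤ (query s).1.length → st s a ≤ pc.eval (inputSize s))
    (O : Oracle PMF) (N : ℕ) (hc : ∀ s, pc.eval (inputSize s) ≤ N →
        c.run O N (HasVal.enc s) = (O (query s).2).map fun a =>
          (HasVal.enc (upd (s, a.take (query s).1.length)), st s (a.take (query s).1.length)))
    (hpt : pt.eval S ≤ N) (hpc : pc.eval S ≤ N) (i M : ℕ) (hM : i < M) (s : σ) (hs : Inv i s) :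
    (whileLoop (t.run O N) (c.run O N) M (HasVal.enc s)).map Prod.fst =
      (iterK (oracleStep query upd O) i s).map HasVal.enc ∧
    ∀ o ∈ (whileLoop (t.run O N) (c.run O N) M (HasVal.enc s)).support,
      o.2 ≤ i * (pt.eval S + pc.eval S) + (pt.eval S + S + 1) := by
  induction M generalizing i s with
  | zero => omega
  | succ M ih =>
    obtain ⟨k, hk, he⟩ := ht s
    have hS := hI.size _ _ hs
    have hkS := hk.trans (eval_poly_mono pt hS)
    have hrun : t.run O N (HasVal.enc s) = PMF.pure (HasVal.enc (test s), k) :=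
      he.run O (hkS.trans hpt)
    have hw : whileLoop (t.run O N) (c.run O N) (M + 1) (HasVal.enc s) =
        (t.run O N (HasVal.enc s)).bind fun b => if b.1.isTrue = true then
          (c.run O N (HasVal.enc s)).bind fun u =>
            (whileLoop (t.run O N) (c.run O N) M u.1).bind fun w =>
              PMF.pure (w.1, b.2 + u.2 + w.2)
        else PMF.pure (HasVal.enc s, b.2 + inputSize s + 1) := rfl
    rw [hw, hrun, PMF.pure_bind]
    cases i with
    | zero =>
      rw [hI.finished s hs]
      have : (HasVal.enc false : Val).isTrue = false := rfl
      simp only [this, Bool.false_eq_true, if_false, iterK, PMF.pure_map,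
        PMF.mem_support_pure_iff]
      refine ⟨trivial, ?_⟩
      rintro o rfl
      simp only
      omega
    | succ i =>
      rw [hI.running i s hs]
      have : (HasVal.enc true : Val).isTrue = true := rfl
      simp only [this, if_true]
      rw [hc s ((eval_poly_mono pc hS).trans hpc), PMF.bind_map]
      have hnext : ∀ a : List Bool, Inv i (upd (s, a.take (query s).1.length)) := fun a =>
        hI.next i s hs _ (by rw [List.length_take]; omega)
      constructor
      · rw [PMF.map_bind, iterK, oracleStep, PMF.bind_map, PMF.map_bind]
        refine pmf_bind_congr fun a _ => ?_
        simp only [Function.comp_apply, PMF.map_bind, PMF.pure_map]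
        exact (ih i (by omega) _ (hnext a)).1
      · intro o ho
        rw [PMF.mem_support_bind_iff] at ho
        obtain ⟨a, -, ho⟩ := ho
        simp only [Function.comp_apply, PMF.mem_support_bind_iff, PMF.mem_support_pure_iff] at ho
        obtain ⟨w, hw, rfl⟩ := ho
        have h1 := (ih i (by omega) _ (hnext a)).2 w hw
        have h2 := (hst s (a.take (query s).1.length) (by rw [List.length_take]; omega)).trans
          (eval_poly_mono pc hS)
        simp only
        rw [add_mul, one_mul]
        omega

theorem oraclePolyTime_loop {init : List Bool × List Bool → σ} {test : σ → Bool}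
    {query : σ → List Bool × List Bool × List Bool} {upd : σ × List Bool → σ} {fin : σ → Bool}
    (hinit : FP init) (htest : FP test) (hquery : FP query) (hupd : FP upd) (hfin : FP fin)
    (rounds : List Bool → ℕ) (q T S : Polynomial ℕ) (Inv : List Bool → ℕ → σ → Prop)
    (hT : ∀ x, rounds x ≤ T.eval x.length)
    (hI : ∀ x, LoopInvariant test query upd (S.eval x.length) (Inv x))
    (hstart : ∀ x ρ : List Bool, ρ.length = q.eval x.length → Inv x (rounds x) (init (x, ρ))) :
    OraclePolyTime fun O x => (unif (q.eval x.length)).bind fun ρ =>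
      (iterK (oracleStep query upd O) (rounds x) (init (x, ρ))).map fin := by
  obtain ⟨c₀, p₀, -, h₀⟩ := hinit
  obtain ⟨t, pt, -, ht⟩ := htest
  obtain ⟨c₁, p₁, -, h₁⟩ := hfin
  obtain ⟨c, pc, st, hst, hc⟩ := exists_code_oracleStep hquery hupd
  -- The argument `2 * X + 2 * q + 3` is the size of the pair of instance and coins. The polynomial
  -- serves both as time bound and as fuel, hence the extra summand `T`.
  let p : Polynomial ℕ := p₀.comp (2 * .X + 2 * q + 3) + T * (pt.comp S + pc.comp S) + pt.comp S +
    pc.comp S + S + p₁.comp S + T + 4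
  refine ⟨.seq c₀ (.seq (.while t c) c₁), p, q, fun O x => ?_⟩
  set n := x.length with hn
  set N := p.eval n with hN
  simp only [p, Polynomial.eval_add, Polynomial.eval_mul, Polynomial.eval_comp,
    Polynomial.eval_X, Polynomial.eval_ofNat] at hN
  have hTx : rounds x ≤ T.eval n := hT x
  have hIx : LoopInvariant test query upd (S.eval n) (Inv x) := hI x
  have hTB := Nat.mul_le_mul_right (pt.eval (S.eval n) + pc.eval (S.eval n)) hTx
  have key : ∀ ρ : List Bool, ρ.length = q.eval n →
      ((Code.seq c₀ (.seq (.while t c) c₁)).run O N (HasVal.enc (x, ρ))).map (fun o => o.1.isTrue) =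
        (iterK (oracleStep query upd O) (rounds x) (init (x, ρ))).map fin ∧
      ∀ o ∈ ((Code.seq c₀ (.seq (.while t c) c₁)).run O N (HasVal.enc (x, ρ))).support,
        o.2 ≤ N := by
    intro ρ hρ
    obtain ⟨s₀, hs₀, he₀⟩ := h₀ (x, ρ)
    have hs₀' : s₀ ≤ p₀.eval (2 * n + 2 * q.eval n + 3) := by
      rw [inputSize_pair, inputSize_bits, inputSize_bits, hρ, ← hn] at hs₀
      convert hs₀ using 2
      ring
    have hr := hstart x ρ hρ
    obtain ⟨hw1, hw2⟩ := whileLoop_oracleStep hIx ht hst O N (hc O N) (by omega) (by omega)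
      (rounds x) N (by omega) _ hr
    set W := whileLoop (t.run O N) (c.run O N) N (HasVal.enc (init (x, ρ))) with hW
    have hfinal : ∀ o ∈ W.support, ∃ s k, o.1 = HasVal.enc s ∧ inputSize s ≤ S.eval n ∧
        k ≤ p₁.eval (S.eval n) ∧ c₁.run O N o.1 = PMF.pure (HasVal.enc (fin s), k) := by
      intro o ho
      have : o.1 ∈ (W.map Prod.fst).support := by
        rw [PMF.mem_support_map_iff]
        exact ⟨o, ho, rfl⟩
      rw [hw1, PMF.mem_support_map_iff] at this
      obtain ⟨s, hs, hso⟩ := this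
      have hs' := hIx.size _ _ (hIx.iterK O (rounds x) 0 _ hr s hs)
      obtain ⟨k, hk, hek⟩ := h₁ s
      have hk' := hk.trans (eval_poly_mono p₁ hs')
      exact ⟨s, k, hso.symm, hs', hk', by rw [← hso]; exact hek.run O (by omega)⟩
    have hrun : (Code.seq c₀ (.seq (.while t c) c₁)).run O N (HasVal.enc (x, ρ)) =
        W.bind fun w => (c₁.run O N w.1).bind fun b =>
          PMF.pure (b.1, s₀ + (w.2 + b.2 + 1) + 1) := by
      change ((c₀.run O N (HasVal.enc (x, ρ))).bind fun a =>
        ((whileLoop (t.run O N) (c.run O N) N a.1).bind fun w => (c₁.run O N w.1).bind fun b =>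
          PMF.pure (b.1, w.2 + b.2 + 1)).bind fun b => PMF.pure (b.1, a.2 + b.2 + 1)) = _
      have : c₀.run O N (HasVal.enc (x, ρ)) = PMF.pure (HasVal.enc (init (x, ρ)), s₀) :=
        he₀.run O (by omega)
      rw [this]
      simp only [PMF.pure_bind, PMF.bind_bind, ← hW]
    rw [hrun]
    constructor
    · have e1 : (iterK (oracleStep query upd O) (rounds x) (init (x, ρ))).map fin =
          ((W.map Prod.fst).bind fun v => (c₁.run O N v).map fun o => o.1.isTrue) := by
        rw [hw1, PMF.bind_map]
        refine pmf_bind_congr fun s hs => ?_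
        have hs' := hIx.size _ _ (hIx.iterK O (rounds x) 0 _ hr s hs)
        obtain ⟨k, hk, hek⟩ := h₁ s
        have hk' := hk.trans (eval_poly_mono p₁ hs')
        have : c₁.run O N (HasVal.enc s) = PMF.pure (HasVal.enc (fin s), k) :=
          hek.run O (by omega)
        rw [Function.comp_apply, Function.comp_apply, this, PMF.pure_map]
        rfl
      rw [e1, PMF.bind_map, PMF.map_bind]
      refine pmf_bind_congr fun w _ => ?_
      rw [PMF.map_bind]
      simp only [PMF.pure_map]
      rfl
    · intro o ho
      rw [PMF.mem_support_bind_iff] at ho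
      obtain ⟨w, hw, ho⟩ := ho
      obtain ⟨s, k, -, -, hk, hr1⟩ := hfinal w hw
      rw [hr1, PMF.pure_bind, PMF.mem_support_pure_iff] at ho
      have := hw2 w hw
      rw [ho]
      simp only
      omega
  refine ⟨fun ρ hρ => (key ρ hρ).2, pmf_bind_congr fun ρ hρ => ?_⟩
  exact (key ρ (mem_support_unif.1 hρ)).1.symm

end PublicCoinZK

namespace PublicCoinZK

variable {α β γ δ σ : Type} [HasVal α] [HasVal β] [HasVal γ] [HasVal δ] [HasVal σ]

/-! ### The reduction attached to a simulator -/

/-- An element of `{0, …, 2 ^ d - 1}`, where `2 ^ d` is the least power of two that is at least `k`,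
read off from the first `d` bits of the string. -/
def index (k : ℕ) (s : List Bool) : ℕ :=
  (s.foldl (fun (a : ℕ × ℕ) b =>
    if a.1 < k then (2 * a.1, 2 * a.2 + if b then 1 else 0) else a) (1, 0)).2

lemma FP.index {k : γ → ℕ} {s : γ → List Bool} (hk : FP k) (hs : FP s) :
    FP fun c => index (k c) (s c) := by
  obtain ⟨p, hp⟩ := hk.size_le
  refine FP.snd.comp (FP.foldl (g := fun c (a : ℕ × ℕ) b =>
    if a.1 < k c then (2 * a.1, 2 * a.2 + if b then 1 else 0) else a) hs (.const (1, 0)) ?_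
    (8 * p + 12) ?_)
  · have h1 : FP fun a : γ × (ℕ × ℕ) × Bool => a.2.1.1 := FP.fst.comp (FP.fst.comp FP.snd)
    have h2 : FP fun a : γ × (ℕ × ℕ) × Bool => a.2.1.2 := FP.snd.comp (FP.fst.comp FP.snd)
    have h3 : FP fun a : γ × (ℕ × ℕ) × Bool => a.2.2 := FP.snd.comp FP.snd
    refine (FP.ite (h1.lt (hk.comp FP.fst)) (((FP.const 2).mul h1).pair (((FP.const 2).mul h2).add
      (h3.ite (.const 1) (.const 0)))) (FP.fst.comp FP.snd)).congr fun a => by simp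
  · intro c l _
    -- The first component is doubled only while it is below `k c`; the `+ 1` covers the start value
    -- `1` when `k c = 0`.
    have key : ∀ (l : List Bool) (a : ℕ × ℕ), a.2 < a.1 → a.1 ≤ 2 * k c + 1 →
        let r := l.foldl (fun (a : ℕ × ℕ) b =>
          if a.1 < k c then (2 * a.1, 2 * a.2 + if b then 1 else 0) else a) a
        r.2 < r.1 ∧ r.1 ≤ 2 * k c + 1 := by
      intro l
      induction l with
      | nil => intro a h1 h2; exact ⟨h1, h2⟩
      | cons b l ih =>
        intro a h1 h2
        rw [List.foldl_cons]
        apply ih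
        · split_ifs <;> omega
        · split_ifs <;> omega
    obtain ⟨h1, h2⟩ := key l (1, 0) (by simp) (by simp)
    have h3 := hp c
    rw [inputSize_nat] at h3
    rw [inputSize_pair, inputSize_nat, inputSize_nat]
    simp only [Polynomial.eval_add, Polynomial.eval_mul, Polynomial.eval_ofNat]
    omega

/-- A partial transcript followed by a string and a bit, written as a bit string of length `M`. -/
def serPartial (M : ℕ) (τ : Transcript) (r : List Bool) (b : Bool) : List Bool :=
  pad M (HasVal.enc (τ, r, b) : Val).ser

lemma enc_bits_injective : Function.Injective (HasVal.enc : List Bool → Val) := by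
  intro l l' h
  rw [← toBits_enc l, h, toBits_enc]

lemma enc_transcript_injective : Function.Injective (HasVal.enc : Transcript → Val) := by
  intro τ
  induction τ with
  | nil =>
    intro τ' h
    cases τ' with
    | nil => rfl
    | cons a τ' => cases h
  | cons a τ ih =>
    intro τ' h
    cases τ' with
    | nil => cases h
    | cons a' τ' =>
      obtain ⟨a1, a2⟩ := a
      obtain ⟨b1, b2⟩ := a'
      have h' : Val.node (Val.node (HasVal.enc a1) (HasVal.enc a2)) (HasVal.enc τ) =
        Val.node (Val.node (HasVal.enc b1) (HasVal.enc b2)) (HasVal.enc τ') := h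
      simp only [Val.node.injEq] at h'
      rw [enc_bits_injective h'.1.1, enc_bits_injective h'.1.2, ih h'.2]

/-- Both serializations fit into length `M`, so nothing is truncated and prefix-freeness removes the
padding. -/
lemma serPartial_inj {M : ℕ} {τ τ' : Transcript} {r r' : List Bool} {b b' : Bool}
    (h : 2 * inputSize (τ, r, b) ≤ M) (h' : 2 * inputSize (τ', r', b') ≤ M)
    (e : serPartial M τ r b = serPartial M τ' r' b') : τ = τ' ∧ r = r' ∧ b = b' := by
  rw [serPartial, serPartial, pad_of_length_le (by rw [Val.length_ser]; exact h),
    pad_of_length_le (by rw [Val.length_ser]; exact h')] at e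
  have e' := (Val.ser_append_inj e).1
  have e'' : Val.node (HasVal.enc τ) (.node (HasVal.enc r) (.atom b)) =
    Val.node (HasVal.enc τ') (.node (HasVal.enc r') (.atom b')) := e'
  simp only [Val.node.injEq, Val.atom.injEq] at e''
  exact ⟨enc_transcript_injective e''.1, enc_bits_injective e''.2.1, e''.2.2⟩

/-- A simulator for the protocol `Γ` all of whose transcripts have the right number of rounds, with
bounds for the number of rounds and for the lengths of strings. -/
structure Simulator (Γ : Protocol) where
  /-- The output of the simulator as a function of the instance and the coins. -/
  sim : List Bool × List Bool → Transcript
  /-- The number of coins of the simulator. -/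
  simCoins : Polynomial ℕ
  /-- A bound on the number of rounds. -/
  indexLen : Polynomial ℕ
  /-- A bound on the number of coins of the verifier. -/
  verCoins : Polynomial ℕ
  /-- A bound on the length of serialized partial transcripts. -/
  serLen : Polynomial ℕ
  fp_sim : FP sim
  fp_coins : FP fun x : List Bool => Γ.coins x.length
  fp_verifier : FP fun a : List Bool × Transcript => Γ.verifier a.1 a.2
  length_sim : ∀ a, (sim a).length = (Γ.coins a.1.length).length
  first_sim : ∀ a, (Γ.coins a.1.length).head? = some 0 → ((sim a).getD 0 ([], [])).1 = []
  rounds_le : ∀ x : List Bool, (Γ.coins x.length).length ≤ indexLen.eval x.length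
  sum_le : ∀ x : List Bool, (Γ.coins x.length).sum ≤ verCoins.eval x.length
  ser_le : ∀ x ρ : List Bool, ρ.length ≤ simCoins.eval x.length → ∀ (j : ℕ) (b : Bool),
    2 * inputSize ((sim (x, ρ)).take j, ((sim (x, ρ)).getD j ([], [])).1, b) ≤
      serLen.eval x.length

namespace Simulator

variable {Γ : Protocol} (D : Simulator Γ)

/-- The input length of the function family. -/
noncomputable def inLen : Polynomial ℕ := D.indexLen + D.simCoins

/-- The simulated transcript computed from an input of the function family. -/
noncomputable def tr (x ρ : List Bool) : Transcript := D.sim (x, ρ.drop (D.indexLen.eval x.length))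

/-- The round chosen by an input of the function family. -/
noncomputable def round (x ρ : List Bool) : ℕ :=
  index (Γ.coins x.length).length (ρ.take (D.indexLen.eval x.length))

/-- The bit of the function value: acceptance in the last round and `true` in the others. -/
noncomputable def bit (j : ℕ) (x ρ : List Bool) : Bool :=
  decide (j + 1 < (Γ.coins x.length).length) || Γ.verifier x (D.tr x ρ)

/-- The function family: simulate a transcript, and return the part before the prover's message in a
random round. -/
noncomputable def fn (x ρ : List Bool) : List Bool :=
  serPartial (D.serLen.eval x.length) ((D.tr x ρ).take (D.round x ρ))
    ((D.tr x ρ).getD (D.round x ρ) ([], [])).1 (D.bit (D.round x ρ) x ρ)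

/-- The query of the cheating prover. -/
noncomputable def query (x : List Bool) (τ : Transcript) (r : List Bool) : List Bool :=
  serPartial (D.serLen.eval x.length) τ r true

/-- The message of the cheating prover, read off from the answer of the oracle. -/
noncomputable def msg (x : List Bool) (τ : Transcript) (a : List Bool) : List Bool :=
  ((D.tr x a).getD τ.length ([], [])).2

/-- The cheating prover. -/
noncomputable def prover (O : Oracle PMF) (x : List Bool) : Strategy := fun τ r =>
  (O (x, D.query x τ r)).map fun a => D.msg x τ (a.take (D.inLen.eval x.length))

/-! ### Efficiency of the function family -/

lemma fp_tr : FP fun a : List Bool × List Bool => D.tr a.1 a.2 :=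
  D.fp_sim.comp (FP.fst.pair ((FP.fst.length.polyEval D.indexLen).drop FP.snd))

lemma fp_rounds (D : Simulator Γ) : FP fun x : List Bool => (Γ.coins x.length).length := D.fp_coins.length

lemma fp_serPartial {M : γ → ℕ} {τ : γ → Transcript} {r : γ → List Bool} {b : γ → Bool}
    (hM : FP M) (hτ : FP τ) (hr : FP r) (hb : FP b) :
    FP fun c => serPartial (M c) (τ c) (r c) (b c) :=
  hM.pad (hτ.pair (hr.pair hb)).enc.ser

lemma fp_fn : FP fun a : List Bool × List Bool => D.fn a.1 a.2 := by
  have hround : FP fun a : List Bool × List Bool => D.round a.1 a.2 :=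
    (D.fp_rounds.comp FP.fst).index ((FP.fst.length.polyEval D.indexLen).take FP.snd)
  have hbit : FP fun a : List Bool × List Bool => D.bit (D.round a.1 a.2) a.1 a.2 :=
    (hround.succ.lt (D.fp_rounds.comp FP.fst)).or (D.fp_verifier.comp (FP.fst.pair D.fp_tr))
  exact fp_serPartial (FP.fst.length.polyEval D.serLen) (hround.take D.fp_tr)
    (FP.fst.comp (hround.getD D.fp_tr (.const ([], [])))) hbit

lemma isPolyTimeFamily_fn : IsPolyTimeFamily D.fn D.inLen D.serLen :=
  ⟨fp_iff.1 D.fp_fn, fun _ _ _ => length_pad _ _⟩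

/-! ### The reduction as an oracle loop -/

/-- States of the reduction: the instance, the lengths of the remaining coins of the verifier, the
remaining random string, and the current transcript. -/
abbrev State : Type := List Bool × List ℕ × List Bool × Transcript

/-- The first component matters only through its length, which caps the part of the answer that is
read. The default `0` concerns states with no round left, where the loop has stopped. -/
noncomputable def stQuery (s : State) : List Bool × List Bool × List Bool :=
  (List.replicate (D.inLen.eval s.1.length) true, s.1,
    D.query s.1 s.2.2.2 (s.2.2.1.take (s.2.1.headD 0)))

noncomputable def stUpd (a : State × List Bool) : State :=
  (a.1.1, a.1.2.1.tail, a.1.2.2.1.drop (a.1.2.1.headD 0),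
    a.1.2.2.2 ++ [(a.1.2.2.1.take (a.1.2.1.headD 0), D.msg a.1.1 a.1.2.2.2 a.2)])

lemma fp_stQuery : FP D.stQuery := by
  have hr : FP fun s : State => s.2.2.1.take (s.2.1.headD 0) :=
    ((FP.fst.comp FP.snd).headD (.const 0)).take (FP.fst.comp (FP.snd.comp FP.snd))
  exact ((FP.fst.length.polyEval _).replicate (.const true)).pair (FP.fst.pair
    (fp_serPartial (FP.fst.length.polyEval _) (FP.snd.comp (FP.snd.comp FP.snd)) hr (.const true)))

lemma fp_msg {x : γ → List Bool} {τ : γ → Transcript} {a : γ → List Bool} (hx : FP x) (hτ : FP τ)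
    (ha : FP a) : FP fun c => D.msg (x c) (τ c) (a c) :=
  FP.snd.comp (hτ.length.getD (D.fp_tr.comp (hx.pair ha)) (.const ([], [])))

lemma fp_stUpd : FP D.stUpd := by
  have hm : FP fun a : State × List Bool => a.1.2.1.headD 0 :=
    ((FP.fst.comp FP.snd).comp FP.fst).headD (.const 0)
  have ht : FP fun a : State × List Bool => a.1.2.2.1 :=
    (FP.fst.comp (FP.snd.comp FP.snd)).comp FP.fst
  have hτ : FP fun a : State × List Bool => a.1.2.2.2 :=
    (FP.snd.comp (FP.snd.comp FP.snd)).comp FP.fst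
  have hx : FP fun a : State × List Bool => a.1.1 := FP.fst.comp FP.fst
  exact hx.pair (((FP.fst.comp FP.snd).comp FP.fst).tail.pair ((hm.drop ht).pair
    (hτ.append (((hm.take ht).pair (D.fp_msg hx hτ FP.snd)).cons (.const [])))))

noncomputable def step (O : Oracle PMF) : State → PMF State := oracleStep D.stQuery D.stUpd O

lemma step_apply (O : Oracle PMF) (x : List Bool) (m : ℕ) (ms : List ℕ) (ρ : List Bool)
    (τ : Transcript) : D.step O (x, m :: ms, ρ, τ) = (D.prover O x τ (ρ.take m)).map fun π =>
      (x, ms, ρ.drop m, τ ++ [(ρ.take m, π)]) := by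
  rw [step, oracleStep, prover, PMF.map_comp]
  simp only [stQuery, List.length_replicate]
  rfl

/-- With a sufficiently long uniform string, the loop of the reduction is an interaction of the
verifier with the cheating prover. -/
lemma bind_iterK_step {β : Type} (O : Oracle PMF) (x : List Bool) (ms : List ℕ) (Q : ℕ)
    (hQ : ms.sum ≤ Q) (τ : Transcript) (F : Transcript → β) :
    ((unif Q).bind fun ρ => (iterK (D.step O) ms.length (x, ms, ρ, τ)).map fun s => F s.2.2.2) =
      (interact (D.prover O x) ms τ).map F := by
  induction ms generalizing Q τ with
  | nil => simp [iterK, interact, PMF.pure_map]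
  | cons m ms ih =>
    rw [List.sum_cons] at hQ
    obtain ⟨Q', rfl⟩ := Nat.exists_eq_add_of_le ((Nat.le_add_right _ _).trans hQ)
    rw [unif_add, PMF.bind_bind, interact, PMF.map_bind]
    refine pmf_bind_congr fun u hu => ?_
    rw [mem_support_unif] at hu
    rw [PMF.bind_map, PMF.map_bind]
    have : ∀ v, ((fun ρ => (iterK (D.step O) (m :: ms).length (x, m :: ms, ρ, τ)).map
        fun s => F s.2.2.2) ∘ fun v => u ++ v) v = (D.prover O x τ u).bind fun π =>
          (iterK (D.step O) ms.length (x, ms, v, τ ++ [(u, π)])).map fun s => F s.2.2.2 := by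
      intro v
      rw [Function.comp_apply, List.length_cons, iterK, step_apply, PMF.bind_map, PMF.map_bind,
        ← hu, List.take_left, List.drop_left]
      rfl
    -- The prover's message is independent of the unused coins; drawing it first makes the induction
    -- hypothesis applicable.
    rw [funext this, PMF.bind_comm]
    exact pmf_bind_congr fun π _ => ih Q' (by omega) _

/-- The invariant of the loop of the reduction: `Z` bounds the sizes at the beginning and `E` the
sizes of the rounds of the transcript. -/
def Inv (Z E : ℕ) (x : List Bool) (i : ℕ) (s : State) : Prop :=
  s.1 = x ∧ s.2.1.length = i ∧ inputSize s.2.1 ≤ Z ∧ s.2.2.1.length ≤ Z ∧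
    s.2.2.2.length + i ≤ Z ∧ ∀ a ∈ s.2.2.2, inputSize a ≤ E

/-- Sizes do not compound over the rounds: a message is computed from the instance and a truncated
answer, and the past affects it only through its length. The initial size `Z` is left free so that
the bounds also apply to the hybrids, which start from a nonempty transcript. -/
lemma exists_loopInvariant : ∃ E S : Polynomial ℕ,
    (∀ Z (x : List Bool), inputSize x ≤ Z →
      LoopInvariant (fun s : State => !s.2.1.isEmpty) D.stQuery D.stUpd (S.eval Z)
        (Inv Z (E.eval Z) x)) ∧
    ∀ Z (s : State), inputSize s ≤ Z → Inv Z (E.eval Z) s.1 s.2.1.length s := by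
  obtain ⟨p, hp⟩ := (D.fp_msg (γ := List Bool × Transcript × List Bool) FP.fst
    (FP.fst.comp FP.snd) (FP.snd.comp FP.snd)).size_le
  obtain ⟨p', hp'⟩ := D.fp_tr.size_le
  let M : Polynomial ℕ := p'.comp (.X + 2 * D.inLen.comp .X + 2) + 1
  have hmsg : ∀ Z (x : List Bool) τ (a : List Bool), inputSize x ≤ Z →
      a.length ≤ D.inLen.eval x.length → inputSize (D.msg x τ a) ≤ M.eval Z := by
    intro Z x τ a hx ha
    have h1 := hp' (x, a)
    have h2 : inputSize (x, a) ≤ Z + 2 * D.inLen.eval Z + 2 := by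
      rw [inputSize_pair, inputSize_bits a]
      have := eval_poly_mono D.inLen ((length_le_inputSize x).trans hx)
      omega
    have h3 := h1.trans (eval_poly_mono p' h2)
    simp only [M, Polynomial.eval_add, Polynomial.eval_mul, Polynomial.eval_comp,
      Polynomial.eval_X, Polynomial.eval_one, Polynomial.eval_ofNat]
    rw [msg, List.getD_eq_getElem?_getD]
    rcases h : (D.tr x a)[τ.length]? with _ | b
    · simp [inputSize_nil]
    · have h4 : inputSize b ≤ inputSize (D.tr x a) := inputSize_le_of_mem (List.mem_of_getElem? h)
      change inputSize (D.tr x a) ≤ _ at h3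
      have h5 : inputSize b = inputSize b.1 + inputSize b.2 + 1 := rfl
      simp only [Option.getD_some]
      omega
  let E : Polynomial ℕ := M + 3 * .X + 2
  refine ⟨E, 5 * .X + .X * (E + 1) + 5, fun Z x hx => ⟨?_, ?_, ?_, ?_⟩, fun Z s hs => ?_⟩
  · rintro i ⟨x', ms, ρ, τ⟩ ⟨rfl, -, h2, h3, h4, h5⟩
    simp only at hx h2 h3 h4 h5
    rw [inputSize_pair, inputSize_pair, inputSize_pair, inputSize_bits ρ]
    have h6 := inputSize_le_of_forall h5
    have h7 : τ.length * (E.eval Z + 1) ≤ Z * (E.eval Z + 1) := Nat.mul_le_mul_right _ (by omega)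
    simp only [Polynomial.eval_add, Polynomial.eval_mul, Polynomial.eval_X, Polynomial.eval_one,
      Polynomial.eval_ofNat]
    omega
  · rintro ⟨x', ms, ρ, τ⟩ ⟨-, h1, -⟩
    simpa using h1
  · rintro i ⟨x', ms, ρ, τ⟩ ⟨-, h1, -⟩
    cases ms with
    | nil => simp at h1
    | cons m ms => rfl
  · rintro i ⟨x', ms, ρ, τ⟩ ⟨rfl, h1, h2, h3, h4, h5⟩ a ha
    simp only [stQuery, List.length_replicate] at ha
    cases ms with
    | nil => simp at h1
    | cons m ms =>
      rw [inputSize_cons] at h2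
      simp only [List.length_cons, add_left_inj] at h1 hx h2 h3 h4 h5
      refine ⟨rfl, h1, by simp only [stUpd, List.tail_cons]; omega, ?_, ?_, ?_⟩
      · simp only [stUpd, List.length_drop]
        omega
      · simp only [stUpd, List.length_append, List.length_cons, List.length_nil]
        omega
      · intro b hb
        simp only [stUpd, List.mem_append, List.mem_singleton, List.headD_cons] at hb
        rcases hb with hb | rfl
        · exact h5 b hb
        · have := hmsg Z x' τ a hx ha
          rw [inputSize_pair, inputSize_bits (ρ.take m), List.length_take]
          simp only [E, Polynomial.eval_add, Polynomial.eval_mul, Polynomial.eval_X,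
            Polynomial.eval_ofNat]
          omega
  · obtain ⟨x, ms, ρ, τ⟩ := s
    rw [inputSize_pair, inputSize_pair, inputSize_pair, inputSize_bits ρ] at hs
    have h1 := length_le_inputSize ms
    have h2 := length_le_inputSize τ
    refine ⟨rfl, rfl, ?_, ?_, ?_, ?_⟩
    · simp only; omega
    · simp only; omega
    · simp only; omega
    · intro a ha
      have : inputSize a ≤ inputSize τ := inputSize_le_of_mem ha
      simp only [E, Polynomial.eval_add, Polynomial.eval_mul, Polynomial.eval_X,
        Polynomial.eval_ofNat]
      omega

/-- The reduction. -/
noncomputable def reduction (O : Oracle PMF) (x : List Bool) : PMF Bool :=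
  (Γ.view (D.prover O x) x).map (Γ.verifier x)

lemma iterK_fst (O : Oracle PMF) (n : ℕ) (s : State) :
    ∀ s' ∈ (iterK (D.step O) n s).support, s'.1 = s.1 := by
  induction n generalizing s with
  | zero => intro s' h; rw [iterK, PMF.mem_support_pure_iff] at h; rw [h]
  | succ n ih =>
    intro s' h
    rw [iterK, PMF.mem_support_bind_iff] at h
    obtain ⟨u, hu, h⟩ := h
    rw [step, oracleStep, PMF.mem_support_map_iff] at hu
    obtain ⟨a, -, rfl⟩ := hu
    exact ih (D.stUpd _) s' h

lemma fp_fin (D : Simulator Γ) : FP fun s : State => Γ.verifier s.1 s.2.2.2 :=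
  D.fp_verifier.comp (FP.fst.pair (FP.snd.comp (FP.snd.comp FP.snd)))

lemma oraclePolyTime_reduction : OraclePolyTime D.reduction := by
  obtain ⟨E, S, h1, h2⟩ := D.exists_loopInvariant
  obtain ⟨p, hp⟩ := D.fp_coins.size_le
  -- A bound for the size of the initial state: instance, coin lengths, random string, empty
  -- transcript and three pairings.
  let Zp : Polynomial ℕ := 2 * .X + 1 + p.comp (2 * .X + 1) + 2 * D.verCoins + 1 + 1 + 3
  have h := oraclePolyTime_loop (init := fun a : List Bool × List Bool =>
      ((a.1, Γ.coins a.1.length, a.2, []) : State)) (test := fun s : State => !s.2.1.isEmpty)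
    (query := D.stQuery) (upd := D.stUpd) (fin := fun s : State => Γ.verifier s.1 s.2.2.2)
    (FP.fst.pair ((D.fp_coins.comp FP.fst).pair (FP.snd.pair (.const []))))
    (FP.not (f := fun s : State => s.2.1.isEmpty) (FP.fst.comp FP.snd).isEmpty)
    D.fp_stQuery D.fp_stUpd D.fp_fin (fun x => (Γ.coins x.length).length) D.verCoins
    D.indexLen (S.comp Zp) (fun x => Inv (Zp.eval x.length) (E.eval (Zp.eval x.length)) x)
    D.rounds_le ?_ ?_
  · convert h using 3 with O x
    rw [reduction, Protocol.view, ← D.bind_iterK_step O x _ _ (D.sum_le x)]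
    refine pmf_bind_congr fun ρ _ => pmf_map_congr fun s hs => ?_
    rw [D.iterK_fst O _ _ s hs]
  · intro x
    rw [Polynomial.eval_comp]
    refine h1 _ x ?_
    rw [inputSize_bits]
    simp only [Zp, Polynomial.eval_add, Polynomial.eval_mul, Polynomial.eval_X,
      Polynomial.eval_ofNat, Polynomial.eval_one]
    omega
  · intro x ρ hρ
    refine h2 _ (x, Γ.coins x.length, ρ, []) ?_
    have h3 := hp x
    rw [inputSize_bits] at h3
    rw [inputSize_pair, inputSize_pair, inputSize_pair, inputSize_bits, inputSize_bits, hρ,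
      inputSize_nil]
    simp only [Zp, Polynomial.eval_add, Polynomial.eval_mul, Polynomial.eval_X,
      Polynomial.eval_ofNat, Polynomial.eval_one, Polynomial.eval_comp]
    omega

end Simulator

end PublicCoinZK

namespace PublicCoinZK

variable {α β γ δ σ : Type} [HasVal α] [HasVal β] [HasVal γ] [HasVal δ] [HasVal σ]

/-! ### Interactions -/

lemma interact_append (P : Strategy) (ms ms' : List ℕ) (τ : Transcript) :
    interact P (ms ++ ms') τ = (interact P ms τ).bind (interact P ms') := by
  induction ms generalizing τ with
  | nil => rw [List.nil_append, interact, PMF.pure_bind]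
  | cons m ms ih =>
    rw [List.cons_append, interact, interact, PMF.bind_bind]
    refine pmf_bind_congr fun r _ => ?_
    rw [PMF.bind_bind]
    exact pmf_bind_congr fun π _ => ih _

lemma mem_support_interact {P : Strategy} {ms : List ℕ} {τ τ' : Transcript}
    (h : τ' ∈ (interact P ms τ).support) :
    ∃ τ₁, τ' = τ ++ τ₁ ∧ τ₁.map (fun a => a.1.length) = ms := by
  induction ms generalizing τ with
  | nil =>
    rw [interact, PMF.mem_support_pure_iff] at h
    exact ⟨[], by simp [h], rfl⟩
  | cons m ms ih =>
    simp only [interact, PMF.mem_support_bind_iff, mem_support_unif] at h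
    obtain ⟨r, hr, π, -, h⟩ := h
    obtain ⟨τ₁, rfl, h₁⟩ := ih h
    exact ⟨(r, π) :: τ₁, by simp, by simp [hr, h₁]⟩

/-! ### Normalized transcripts -/

/-- Truncate the first random string of a transcript to length `m`. -/
def trimFirst (m : ℕ) (τ : Transcript) : Transcript :=
  listCase τ [] fun a l => (a.1.take m, a.2) :: l

/-- Force a transcript to have as many rounds as the list has entries, and force the length of the
first random string. -/
def normalize (ms : List ℕ) (τ : Transcript) : Transcript :=
  trimFirst (ms.headD 0) ((τ ++ List.replicate ms.length ([], [])).take ms.length)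

lemma FP.normalize {ms : γ → List ℕ} {τ : γ → Transcript} (hm : FP ms) (hτ : FP τ) :
    FP fun c => normalize (ms c) (τ c) := by
  refine FP.listCase (h := fun c (a : List Bool × List Bool) l =>
    (a.1.take ((ms c).headD 0), a.2) :: l)
    (hm.length.take (hτ.append (hm.length.replicate (.const ([], []))))) (.const []) ?_
  have ha : FP fun a : γ × (List Bool × List Bool) × Transcript => a.2.1 := FP.fst.comp FP.snd
  exact ((((hm.comp FP.fst).headD (.const 0)).take (FP.fst.comp ha)).pair (FP.snd.comp ha)).cons
    (FP.snd.comp FP.snd)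

lemma length_normalize (ms : List ℕ) (τ : Transcript) : (normalize ms τ).length = ms.length := by
  have h : ∀ (m : ℕ) (τ : Transcript), (trimFirst m τ).length = τ.length := by
    rintro m (_ | ⟨a, l⟩) <;> rfl
  simp [normalize, h]

lemma first_normalize {ms : List ℕ} (h : ms.head? = some 0) (τ : Transcript) :
    ((normalize ms τ).getD 0 ([], [])).1 = [] := by
  have h' : ∀ τ : Transcript, ((trimFirst 0 τ).getD 0 ([], [])).1 = [] := by
    rintro (_ | ⟨a, l⟩) <;> rfl
  rw [normalize, show ms.headD 0 = 0 by rw [List.headD_eq_head?_getD, h]; rfl]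
  exact h' _

lemma normalize_eq_self {ms : List ℕ} {τ : Transcript} (h : τ.map (fun a => a.1.length) = ms) :
    normalize ms τ = τ := by
  subst h
  rw [normalize, List.take_append_of_le_length (by simp), List.take_of_length_le (by simp)]
  cases τ with
  | nil => rfl
  | cons a τ => simp [trimFirst, listCase]

/-- Genuine transcripts already have the right shape. The simulator's output can thus be normalized
without loss, the normalization being made part of the distinguisher. -/
lemma view_map_normalize (Γ : Protocol) (P : Strategy) (x : List Bool) :
    (Γ.view P x).map (normalize (Γ.coins x.length)) = Γ.view P x := by
  conv_rhs => rw [← PMF.map_id (Γ.view P x)]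
  refine pmf_map_congr fun τ hτ => ?_
  obtain ⟨τ₁, rfl, h⟩ := mem_support_interact hτ
  exact normalize_eq_self h

lemma sum_le_inputSize (l : List ℕ) : l.sum ≤ inputSize l := by
  induction l with
  | nil => simp
  | cons m l ih =>
    rw [List.sum_cons, inputSize_cons, inputSize_nat]
    omega

lemma exists_simulator {Γ : Protocol} (hΓ : Γ.EfficientVerifier) {Sim : List Bool → PMF Transcript}
    (hSim : PPT Sim) : ∃ D : Simulator Γ, ∀ x : List Bool,
      (Sim x).map (normalize (Γ.coins x.length)) =
        (unif (D.simCoins.eval x.length)).map fun ρ => D.sim (x, ρ) := by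
  obtain ⟨h, q, hh, hS⟩ := hSim
  have hcoins : FP fun x : List Bool => Γ.coins x.length :=
    (fp_iff.2 hΓ.1).of_enc_eq (fun c => c) _ (fun _ => rfl) fun x => by
      induction Γ.coins x.length with
      | nil => rfl
      | cons m l ih => exact congrArg (Val.node _) ih
  obtain ⟨p, hp⟩ := hcoins.size_le
  have hp' : ∀ x : List Bool,
      inputSize (Γ.coins x.length) ≤ (p.comp (2 * .X + 1)).eval x.length := by
    intro x
    have := hp x
    rw [inputSize_bits] at this
    simpa using this
  have hsim : FP fun a : List Bool × List Bool => normalize (Γ.coins a.1.length) (h a) :=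
    (hcoins.comp FP.fst).normalize (fp_iff.2 hh)
  obtain ⟨r, hr⟩ := hsim.size_le
  refine ⟨⟨fun a => normalize (Γ.coins a.1.length) (h a), q.comp (2 * .X + 1),
    p.comp (2 * .X + 1), p.comp (2 * .X + 1),
    -- If `R` bounds the transcript, then prefix and random string have size at most `R` each; with
    -- the bit and two pairings this makes `2 * (R + R + 1 + 2)` bits.
    4 * r.comp (2 * .X + 2 * q.comp (2 * .X + 1) + 3) + 6, hsim, hcoins, fp_iff.2 hΓ.2,
    fun _ => length_normalize _ _, fun _ h0 => first_normalize h0 _,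
    fun x => (length_le_inputSize _).trans (hp' x), fun x => (sum_le_inputSize _).trans (hp' x),
    fun x ρ hρ j b => ?_⟩, fun x => ?_⟩
  · have h1 := hr (x, ρ)
    set τ := normalize (Γ.coins (x, ρ).1.length) (h (x, ρ)) with hτ
    have h2 := inputSize_take_le j τ
    have h3 : inputSize (τ.getD j ([], [])).1 ≤ inputSize τ := by
      rw [List.getD_eq_getElem?_getD]
      rcases hj : τ[j]? with _ | a
      · exact one_le_inputSize _
      · have h4 := inputSize_le_of_mem (List.mem_of_getElem? hj)
        have h5 : inputSize a = inputSize a.1 + inputSize a.2 + 1 := rfl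
        rw [Option.getD_some]
        omega
    have h6 : inputSize (x, ρ) ≤
        2 * x.length + 2 * (q.comp (2 * .X + 1)).eval x.length + 3 := by
      rw [inputSize_pair, inputSize_bits, inputSize_bits]
      omega
    have h7 := h1.trans (eval_poly_mono r h6)
    rw [inputSize_pair, inputSize_pair, inputSize_bool]
    simp only [Polynomial.eval_add, Polynomial.eval_mul, Polynomial.eval_comp, Polynomial.eval_X,
      Polynomial.eval_one, Polynomial.eval_ofNat] at h7 ⊢
    omega
  · rw [hS, PMF.map_comp]
    simp only [Polynomial.eval_add, Polynomial.eval_mul, Polynomial.eval_comp, Polynomial.eval_X,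
      Polynomial.eval_one, Polynomial.eval_ofNat, inputSize_bits]
    rfl

namespace Simulator

variable {Γ : Protocol} (D : Simulator Γ)

/-! ### Efficiency of the cheating prover and of the hybrid tests -/

lemma ppt_step {A : List Bool × List Bool → PMF (List Bool)} (hA : PPT A) : PPT (D.step A) := by
  have h := (hA.comp (FP.snd.comp D.fp_stQuery)).map
    (f := fun s a => D.stUpd (s, a.take (D.stQuery s).1.length))
    (D.fp_stUpd.comp (FP.fst.pair
      ((FP.fst.comp (D.fp_stQuery.comp FP.fst)).length.take FP.snd)))
  exact h

lemma ppt_prover {A : List Bool × List Bool → PMF (List Bool)} (hA : PPT A) :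
    PPT fun a : List Bool × Transcript × List Bool => D.prover A a.1 a.2.1 a.2.2 := by
  have hq : FP fun a : List Bool × Transcript × List Bool => (a.1, D.query a.1 a.2.1 a.2.2) :=
    FP.fst.pair (fp_serPartial (FP.fst.length.polyEval _) (FP.fst.comp FP.snd)
      (FP.snd.comp FP.snd) (.const true))
  refine (hA.comp hq).map (f := fun (a : List Bool × Transcript × List Bool) ans =>
    D.msg a.1 a.2.1 (ans.take (D.inLen.eval a.1.length))) ?_
  exact D.fp_msg (FP.fst.comp FP.fst) (FP.fst.comp (FP.snd.comp FP.fst))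
    (((FP.fst.comp FP.fst).length.polyEval _).take FP.snd)

/-- This needs nothing of the oracle, since its answers are truncated before a message is read off.
Computational soundness asks for the bound. -/
lemma exists_prover_bound (A : List Bool × List Bool → PMF (List Bool)) : ∃ b : Polynomial ℕ,
    ∀ x τ r, ∀ π ∈ (D.prover A x τ r).support, π.length ≤ b.eval x.length := by
  obtain ⟨p, hp⟩ := D.fp_tr.size_le
  refine ⟨p.comp (2 * .X + 2 * D.inLen + 3), fun x τ r π hπ => ?_⟩
  rw [prover, PMF.mem_support_map_iff] at hπ
  obtain ⟨a, -, rfl⟩ := hπ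
  set a' := a.take (D.inLen.eval x.length) with ha
  have h1 := hp (x, a')
  have h2 : inputSize (x, a') ≤ 2 * x.length + 2 * D.inLen.eval x.length + 3 := by
    rw [inputSize_pair, inputSize_bits, inputSize_bits, ha, List.length_take]
    omega
  have h3 := h1.trans (eval_poly_mono p h2)
  simp only [Polynomial.eval_add, Polynomial.eval_mul, Polynomial.eval_comp,
    Polynomial.eval_X, Polynomial.eval_ofNat]
  change inputSize (D.tr x a') ≤ _ at h3
  rw [msg, List.getD_eq_getElem?_getD]
  rcases h : (D.tr x a')[τ.length]? with _ | b
  · simp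
  · have h4 : inputSize b ≤ inputSize (D.tr x a') := inputSize_le_of_mem (List.mem_of_getElem? h)
    have h5 : inputSize b = inputSize b.1 + inputSize b.2 + 1 := rfl
    have h6 := length_le_inputSize b.2
    simp only [Option.getD_some]
    omega

/-- Whether the verifier accepts when the cheating prover takes over after `j` rounds. -/
noncomputable def before (O : Oracle PMF) (x : List Bool) (j : ℕ) (τ : Transcript) : PMF Bool :=
  (interact (D.prover O x) ((Γ.coins x.length).drop j) (τ.take j)).map (Γ.verifier x)

/-- Whether the verifier accepts when the cheating prover takes over after `j` rounds and the next
random string of the verifier. -/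
noncomputable def after (O : Oracle PMF) (x : List Bool) (j : ℕ) (τ : Transcript) : PMF Bool :=
  (D.prover O x (τ.take j) (τ.getD j ([], [])).1).bind fun π =>
    (interact (D.prover O x) ((Γ.coins x.length).drop (j + 1))
      (τ.take j ++ [((τ.getD j ([], [])).1, π)])).map (Γ.verifier x)

/-- The initial state in the simulation of `before` and, if the flag is set, of `after`. -/
def hybridState (Γ : Protocol) (flag : Bool) (j : ℕ) (x : List Bool) (τ : Transcript)
    (ρ : List Bool) : State :=
  if flag = true then
    (x, (τ.getD j ([], [])).1.length :: (Γ.coins x.length).drop (j + 1),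
      (τ.getD j ([], [])).1 ++ ρ, τ.take j)
  else (x, (Γ.coins x.length).drop j, ρ, τ.take j)

/-- The test `before` or, if the first flag is set, `after`. If the second flag is set, acceptance
of the transcript and rejection in that test. -/
noncomputable def hybrid (O : Oracle PMF) (flag flag' : Bool) (j : ℕ) (x : List Bool)
    (τ : Transcript) : PMF Bool :=
  (if flag = true then D.after O x j τ else D.before O x j τ).map fun b =>
    if flag' = true then Γ.verifier x τ && !b else b

/-- Both tests are runs of the reduction's loop. For `after`, the given random string is put in
front of the coins as a round of exactly its own length. -/
lemma bind_hybridState (O : Oracle PMF) (flag : Bool) (j : ℕ) (x : List Bool) (τ : Transcript) :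
    ((unif (D.verCoins.eval x.length)).bind fun ρ =>
      (iterK (D.step O) (hybridState Γ flag j x τ ρ).2.1.length (hybridState Γ flag j x τ ρ)).map
        fun s => Γ.verifier s.1 s.2.2.2) =
      if flag = true then D.after O x j τ else D.before O x j τ := by
  have hsum : ∀ i, ((Γ.coins x.length).drop i).sum ≤ D.verCoins.eval x.length := fun i =>
    (List.Sublist.sum_le_sum (List.drop_sublist i _) (by simp)).trans (D.sum_le x)
  have hx : ∀ (n : ℕ) (s : State), s.1 = x → (iterK (D.step O) n s).map
      (fun s => Γ.verifier s.1 s.2.2.2) =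
        (iterK (D.step O) n s).map fun s => Γ.verifier x s.2.2.2 := fun n s hs =>
    pmf_map_congr fun s' hs' => by rw [D.iterK_fst O n s s' hs', hs]
  cases flag with
  | false =>
    simp only [hybridState, Bool.false_eq_true, if_false]
    rw [before, ← D.bind_iterK_step O x _ _ (hsum j)]
    exact pmf_bind_congr fun ρ _ => hx _ _ rfl
  | true =>
    simp only [hybridState, if_true]
    rw [after]
    set r := (τ.getD j ([], [])).1 with hr
    have : ∀ ρ : List Bool, (iterK (D.step O) (r.length :: (Γ.coins x.length).drop (j + 1)).length
        (x, r.length :: (Γ.coins x.length).drop (j + 1), r ++ ρ, τ.take j)).map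
          (fun s => Γ.verifier s.1 s.2.2.2) = (D.prover O x (τ.take j) r).bind fun π =>
          (iterK (D.step O) ((Γ.coins x.length).drop (j + 1)).length
            (x, (Γ.coins x.length).drop (j + 1), ρ, τ.take j ++ [(r, π)])).map
            fun s => Γ.verifier x s.2.2.2 := by
      intro ρ
      rw [hx _ _ rfl, List.length_cons, iterK, step_apply, PMF.bind_map, PMF.map_bind,
        List.take_left, List.drop_left]
      rfl
    rw [funext this, PMF.bind_comm]
    exact pmf_bind_congr fun π _ => D.bind_iterK_step O x _ _ (hsum (j + 1)) _ _

/-- The hybrid tests are efficient, uniformly in the parameters, which are read off from the advice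
string. -/
lemma ppt_hybrid {A : List Bool × List Bool → PMF (List Bool)} (hA : PPT A) :
    PPT fun a : List Bool × List Bool × Transcript =>
      D.hybrid A (a.1.getD 0 false) (a.1.getD 1 false) (a.1.length - 2) a.2.1
        (normalize (Γ.coins a.2.1.length) a.2.2) := by
  have hz : FP fun a : List Bool × List Bool × Transcript => a.1 := FP.fst
  have hx : FP fun a : List Bool × List Bool × Transcript => a.2.1 := FP.fst.comp FP.snd
  have hτ : FP fun a : List Bool × List Bool × Transcript =>
      normalize (Γ.coins a.2.1.length) a.2.2 :=
    (D.fp_coins.comp hx).normalize (FP.snd.comp FP.snd)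
  have hj : FP fun a : List Bool × List Bool × Transcript => a.1.length - 2 :=
    hz.length.sub (.const 2)
  have hflag : ∀ i : ℕ, FP fun a : List Bool × List Bool × Transcript => a.1.getD i false :=
    fun i => (FP.const i).getD hz (.const false)
  let st : (List Bool × List Bool × Transcript) × List Bool → State := fun c =>
    hybridState Γ (c.1.1.getD 0 false) (c.1.1.length - 2) c.1.2.1
      (normalize (Γ.coins c.1.2.1.length) c.1.2.2) c.2
  have hst : FP st := by
    have hx' := hx.comp (FP.fst (β := List Bool))
    have hτ' := hτ.comp (FP.fst (β := List Bool))
    have hj' := hj.comp (FP.fst (β := List Bool))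
    have hr := FP.fst.comp (hj'.getD hτ' (.const ([], [])))
    exact FP.ite ((hflag 0).comp FP.fst)
      (hx'.pair ((hr.length.cons (hj'.succ.drop (D.fp_coins.comp hx'))).pair
        ((hr.append FP.snd).pair (hj'.take hτ'))))
      (hx'.pair ((hj'.drop (D.fp_coins.comp hx')).pair (FP.snd.pair (hj'.take hτ'))))
  obtain ⟨E, S, h1, h2⟩ := D.exists_loopInvariant
  obtain ⟨p, hp⟩ := hst.size_le
  have hiter : PPT fun c => iterK (D.step A) (st c).2.1.length (st c) := by
    refine (D.ppt_step hA).iterate (FP.fst.comp (FP.snd.comp hst)).length hst (S.comp p)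
      fun c i hi s' hs' => ?_
    obtain ⟨j, hj⟩ := Nat.exists_eq_add_of_le hi
    have hsx : inputSize (st c).1 ≤ p.eval (inputSize c) := by
      have := hp c
      have e : inputSize (st c) = inputSize (st c).1 + inputSize (st c).2 + 1 := rfl
      omega
    have hI := h1 _ _ hsx
    have hstart := h2 _ _ (hp c)
    rw [hj] at hstart
    rw [Polynomial.eval_comp]
    exact hI.size _ _ (hI.iterK A i j _ hstart s' hs')
  have hfin : FP fun a : ((List Bool × List Bool × Transcript) × List Bool) × State =>
      if a.1.1.1.getD 1 false = true then
        Γ.verifier a.1.1.2.1 (normalize (Γ.coins a.1.1.2.1.length) a.1.1.2.2) &&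
          !Γ.verifier a.2.1 a.2.2.2.2
      else Γ.verifier a.2.1 a.2.2.2.2 := by
    have hf := D.fp_fin.comp (FP.snd (α := (List Bool × List Bool × Transcript) × List Bool))
    have hin : FP fun a : ((List Bool × List Bool × Transcript) × List Bool) × State => a.1.1 :=
      FP.fst.comp FP.fst
    exact FP.ite ((hflag 1).comp hin) (((D.fp_verifier.comp (hx.pair hτ)).comp hin).and hf.not) hf
  have h := (PPT.unif (hx.length.polyEval D.verCoins)).bind
    (B := fun (a : List Bool × List Bool × Transcript) ρ =>
      (iterK (D.step A) (st (a, ρ)).2.1.length (st (a, ρ))).map fun s =>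
        if a.1.getD 1 false = true then
          Γ.verifier a.2.1 (normalize (Γ.coins a.2.1.length) a.2.2) && !Γ.verifier s.1 s.2.2.2
        else Γ.verifier s.1 s.2.2.2) (hiter.map hfin)
  convert h using 2 with a
  rw [hybrid, ← bind_hybridState, PMF.map_bind]
  refine pmf_bind_congr fun ρ _ => ?_
  rw [PMF.map_comp]
  rfl

end Simulator

end PublicCoinZK

namespace PublicCoinZK

/-! ### Probabilities of tests -/

/-- The probability of the outcome `true`. -/
noncomputable def pr (p : PMF Bool) : ℝ := (p true).toReal

lemma pr_nonneg (p : PMF Bool) : 0 ≤ pr p := ENNReal.toReal_nonneg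

lemma pr_le_one (p : PMF Bool) : pr p ≤ 1 :=
  ENNReal.toReal_le_of_le_ofReal zero_le_one (by simpa using p.coe_le_one true)

lemma pr_pure (b : Bool) : pr (PMF.pure b) = if b = true then 1 else 0 := by
  cases b <;> simp [pr, PMF.pure_apply]

lemma pmf_summable {α : Type} (P : PMF α) : Summable fun a => (P a).toReal :=
  ENNReal.summable_toReal (by rw [P.tsum_coe]; exact ENNReal.one_ne_top)

lemma pmf_summable_mul {α : Type} (P : PMF α) (F : α → ℝ) (h0 : ∀ a, 0 ≤ F a)
    (h1 : ∀ a, F a ≤ 1) : Summable fun a => (P a).toReal * F a :=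
  (pmf_summable P).of_nonneg_of_le (fun a => mul_nonneg ENNReal.toReal_nonneg (h0 a))
    fun a => mul_le_of_le_one_right ENNReal.toReal_nonneg (h1 a)

lemma pr_bind {α : Type} (P : PMF α) (g : α → PMF Bool) :
    pr (P.bind g) = ∑' a, (P a).toReal * pr (g a) := by
  rw [pr, PMF.bind_apply, ENNReal.tsum_toReal_eq]
  · simp [pr]
  · intro a
    exact ENNReal.mul_ne_top (P.apply_ne_top a) ((g a).apply_ne_top true)

lemma pmf_tsum_toReal {α : Type} (P : PMF α) : ∑' a, (P a).toReal = 1 := by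
  rw [← ENNReal.tsum_toReal_eq fun a => P.apply_ne_top a, P.tsum_coe, ENNReal.toReal_one]

lemma pr_bind_mono {α : Type} {P : PMF α} {g g' : α → PMF Bool}
    (h : ∀ a ∈ P.support, pr (g a) ≤ pr (g' a)) : pr (P.bind g) ≤ pr (P.bind g') := by
  rw [pr_bind, pr_bind]
  refine Summable.tsum_le_tsum (fun a => ?_)
    (pmf_summable_mul P _ (fun a => pr_nonneg _) fun a => pr_le_one _)
    (pmf_summable_mul P _ (fun a => pr_nonneg _) fun a => pr_le_one _)
  by_cases ha : a ∈ P.support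
  · exact mul_le_mul_of_nonneg_left (h a ha) ENNReal.toReal_nonneg
  · rw [PMF.mem_support_iff, not_not] at ha
    simp [ha]

lemma pr_bind_add {α : Type} {P : PMF α} {g g₁ g₂ : α → PMF Bool}
    (h : ∀ a ∈ P.support, pr (g a) = pr (g₁ a) + pr (g₂ a)) :
    pr (P.bind g) = pr (P.bind g₁) + pr (P.bind g₂) := by
  rw [pr_bind, pr_bind, pr_bind, ← Summable.tsum_add
    (pmf_summable_mul P _ (fun a => pr_nonneg _) fun a => pr_le_one _)
    (pmf_summable_mul P _ (fun a => pr_nonneg _) fun a => pr_le_one _)]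
  refine tsum_congr fun a => ?_
  by_cases ha : a ∈ P.support
  · rw [h a ha, mul_add]
  · rw [PMF.mem_support_iff, not_not] at ha
    simp [ha]

lemma pr_bind_le_add {α : Type} {P : PMF α} {g g₁ g₂ : α → PMF Bool}
    (h : ∀ a ∈ P.support, pr (g a) ≤ pr (g₁ a) + pr (g₂ a)) :
    pr (P.bind g) ≤ pr (P.bind g₁) + pr (P.bind g₂) := by
  rw [pr_bind, pr_bind, pr_bind, ← Summable.tsum_add
    (pmf_summable_mul P _ (fun a => pr_nonneg _) fun a => pr_le_one _)
    (pmf_summable_mul P _ (fun a => pr_nonneg _) fun a => pr_le_one _)]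
  refine Summable.tsum_le_tsum (fun a => ?_)
    (pmf_summable_mul P _ (fun a => pr_nonneg _) fun a => pr_le_one _)
    ((pmf_summable_mul P _ (fun a => pr_nonneg _) fun a => pr_le_one _).add
      (pmf_summable_mul P _ (fun a => pr_nonneg _) fun a => pr_le_one _))
  by_cases ha : a ∈ P.support
  · rw [← mul_add]
    exact mul_le_mul_of_nonneg_left (h a ha) ENNReal.toReal_nonneg
  · rw [PMF.mem_support_iff, not_not] at ha
    simp [ha]

/-- With `d` the difference of the two masses, each term is at most the positive part `(|d| + d) /
2`, and the `d` sum to zero. -/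
lemma pr_bind_le_statDist {α : Type} (P Q : PMF α) (g : α → PMF Bool) :
    pr (P.bind g) ≤ pr (Q.bind g) + statDist P Q := by
  have hP := pmf_summable P
  have hQ := pmf_summable Q
  have hPg := pmf_summable_mul P _ (fun a => pr_nonneg (g a)) fun a => pr_le_one _
  have hQg := pmf_summable_mul Q _ (fun a => pr_nonneg (g a)) fun a => pr_le_one _
  have h0 : ∑' a, ((P a).toReal - (Q a).toReal) = 0 := by
    rw [hP.tsum_sub hQ, pmf_tsum_toReal, pmf_tsum_toReal, sub_self]
  have habs : Summable fun a => |(P a).toReal - (Q a).toReal| := (hP.sub hQ).abs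
  have key : ∑' a, ((P a).toReal * pr (g a) - (Q a).toReal * pr (g a)) ≤
      ∑' a, (1 / 2) * (|(P a).toReal - (Q a).toReal| + ((P a).toReal - (Q a).toReal)) := by
    refine Summable.tsum_le_tsum (fun a => ?_) (hPg.sub hQg)
      ((habs.add (hP.sub hQ)).mul_left _)
    rw [← sub_mul]
    have h1 := pr_nonneg (g a)
    have h2 := pr_le_one (g a)
    rcases abs_cases ((P a).toReal - (Q a).toReal) with ⟨h, h'⟩ | ⟨h, h'⟩ <;> rw [h] <;> nlinarith
  rw [hPg.tsum_sub hQg, tsum_mul_left, habs.tsum_add (hP.sub hQ), h0, add_zero, ← pr_bind,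
    ← pr_bind] at key
  rw [statDist]
  linarith

/-! ### The distribution of the random round -/

/-- Dyadic descent: `d` is the number of doublings left, and `J` lies in the block of length `2 ^ d`
belonging to `a`. Exactly one value of the next bit selects the half containing `J`, at a cost of a
factor `1 / 2`. -/
lemma foldl_index_prob (k J d m N a : ℕ) (hd : d ≤ m) (h1 : k ≤ N * 2 ^ d)
    (h2 : d = 0 ∨ N * 2 ^ (d - 1) < k) (h3 : a * 2 ^ d ≤ J) (h4 : J < (a + 1) * 2 ^ d) :
    ((2 : ENNReal) ^ d)⁻¹ ≤ ((unif m).map fun s : List Bool =>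
      (s.foldl (fun (a : ℕ × ℕ) b =>
        if a.1 < k then (2 * a.1, 2 * a.2 + if b then 1 else 0) else a) (N, a)).2) J := by
  induction d generalizing m N a with
  | zero =>
    have hN : ¬ N < k := by simp at h1; omega
    have : ∀ s : List Bool, s.foldl (fun (a : ℕ × ℕ) b =>
        if a.1 < k then (2 * a.1, 2 * a.2 + if b then 1 else 0) else a) (N, a) = (N, a) := by
      intro s
      induction s with
      | nil => rfl
      | cons b s ih => rw [List.foldl_cons, if_neg hN, ih]
    have haJ : a = J := by simp at h3 h4; omega
    rw [pmf_map_congr (g := Function.const _ a) fun s _ => congrArg Prod.snd (this s),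
      PMF.map_const, haJ]
    simp [PMF.pure_apply]
  | succ d ih =>
    obtain ⟨m, rfl⟩ : ∃ m', m = 1 + m' := ⟨m - 1, by omega⟩
    have hN : N < k := by
      rcases h2 with h2 | h2
      · omega
      · exact (Nat.le_mul_of_pos_right N (by positivity)).trans_lt h2
    rw [unif_add, PMF.map_bind, PMF.bind_apply]
    obtain ⟨b, hb3, hb4⟩ : ∃ b : Bool, (2 * a + if b then 1 else 0) * 2 ^ d ≤ J ∧
        J < ((2 * a + if b then 1 else 0) + 1) * 2 ^ d := by
      rw [pow_succ] at h3 h4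
      by_cases h : J < (2 * a + 1) * 2 ^ d
      · exact ⟨false, by simp only [Bool.false_eq_true, if_false]; linarith, by simpa using h⟩
      · exact ⟨true, by simpa using h, by simp only [if_true]; linarith⟩
    refine le_trans ?_ (ENNReal.le_tsum [b])
    rw [unif_apply, PMF.map_comp, pow_succ, mul_comm ((2 : ENNReal) ^ d),
      ENNReal.mul_inv (by simp) (by simp)]
    refine mul_le_mul' (by simp) ?_
    have := ih m (2 * N) (2 * a + if b then 1 else 0) (by omega) (by rw [pow_succ] at h1; linarith)
      (by
        rcases h2 with h2 | h2
        · omega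
        · rcases Nat.eq_zero_or_pos d with h | h
          · exact Or.inl h
          · obtain ⟨e, rfl⟩ := Nat.exists_eq_add_of_lt h
            right
            simp only [zero_add, Nat.add_sub_cancel] at h2 ⊢
            rw [pow_succ] at h2
            linarith) hb3 hb4
    refine this.trans_eq (congrArg (fun p : PMF ℕ => p J) (pmf_map_congr fun s _ => ?_))
    simp [hN]

/-- A uniform choice among exactly `k` rounds is not needed. The least power of two above `k` is at
most `2 * k - 2` when `k > 1`, and is `1` when `k = 1`, hence at most `t` in either case. -/
lemma index_prob {k B t : ℕ} (hB : k ≤ B) (hk : 1 ≤ k) (ht : 2 * k ≤ t + 1) {J : ℕ} (hJ : J < k) :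
    1 / (t : ℝ) ≤ (((unif B).map (index k)) J).toReal := by
  have hclog : k ≤ 2 ^ Nat.clog 2 k := Nat.le_pow_clog (by norm_num) k
  have h1 : ((2 : ENNReal) ^ Nat.clog 2 k)⁻¹ ≤ ((unif B).map (index k)) J := by
    refine foldl_index_prob k J (Nat.clog 2 k) B 1 0 ?_ (by simpa using hclog) ?_ (by simp)
      (by simpa using hJ.trans_le hclog)
    · exact (Nat.clog_le_of_le_pow (Nat.lt_two_pow_self.le)).trans hB
    · rcases Nat.lt_or_ge 1 k with h | h
      · right
        rw [one_mul]
        exact Nat.pow_pred_clog_lt_self (by norm_num) h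
      · left
        exact Nat.clog_of_right_le_one h 2
  have h2 : 2 ^ Nat.clog 2 k ≤ t := by
    rcases Nat.lt_or_ge 1 k with h | h
    · have h3 : 2 ^ (Nat.clog 2 k - 1) < k := Nat.pow_pred_clog_lt_self (by norm_num) h
      have h4 : 0 < Nat.clog 2 k := Nat.clog_pos (by norm_num) h
      have h5 : 2 ^ Nat.clog 2 k = 2 * 2 ^ (Nat.clog 2 k - 1) := by
        rw [← pow_succ', Nat.sub_add_cancel h4]
      omega
    · rw [Nat.clog_of_right_le_one h 2]
      omega
  have h3 := ENNReal.toReal_mono (PMF.apply_ne_top _ _) h1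
  refine le_trans ?_ h3
  rw [ENNReal.toReal_inv, ENNReal.toReal_pow, ENNReal.toReal_ofNat, one_div]
  exact inv_anti₀ (by positivity) (by exact_mod_cast h2)

/-- All gaps are nonnegative, so the indices beyond `k` can be dropped and the weights lowered to `1
/ t`. -/
lemma sum_le_of_weights {k t : ℕ} {δ : ℝ} (W : PMF ℕ) (A B : ℕ → PMF Bool) (ht : 0 < t)
    (hW : ∀ j < k, 1 / (t : ℝ) ≤ (W j).toReal) (hAB : ∀ j, pr (B j) ≤ pr (A j))
    (h : pr (W.bind A) ≤ pr (W.bind B) + δ) :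
    ∑ j ∈ Finset.range k, (pr (A j) - pr (B j)) ≤ t * δ := by
  have hA := pmf_summable_mul W _ (fun a => pr_nonneg (A a)) fun a => pr_le_one _
  have hB := pmf_summable_mul W _ (fun a => pr_nonneg (B a)) fun a => pr_le_one _
  rw [pr_bind, pr_bind] at h
  have h1 : ∑ j ∈ Finset.range k, ((W j).toReal * pr (A j) - (W j).toReal * pr (B j)) ≤ δ := by
    refine (Summable.sum_le_tsum _ (fun j _ => ?_) (hA.sub hB)).trans ?_
    · rw [← mul_sub]
      exact mul_nonneg ENNReal.toReal_nonneg (sub_nonneg.2 (hAB j))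
    · rw [hA.tsum_sub hB]
      linarith
  have h2 : ∑ j ∈ Finset.range k, (1 / (t : ℝ)) * (pr (A j) - pr (B j)) ≤ δ := by
    refine (Finset.sum_le_sum fun j hj => ?_).trans h1
    rw [← mul_sub]
    exact mul_le_mul_of_nonneg_right (hW j (Finset.mem_range.1 hj)) (sub_nonneg.2 (hAB j))
  rw [← Finset.mul_sum, one_div, inv_mul_le_iff₀ (by exact_mod_cast ht)] at h2
  exact h2

end PublicCoinZK

namespace PublicCoinZK

/-! ### Simulated messages versus inverter messages -/

namespace Simulator

variable {Γ : Protocol} (D : Simulator Γ)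

/-- The distribution of simulated transcripts. -/
noncomputable def dist (x : List Bool) : PMF Transcript :=
  (unif (D.simCoins.eval x.length)).map fun ρ => D.sim (x, ρ)

lemma length_tr (x ρ : List Bool) : (D.tr x ρ).length = (Γ.coins x.length).length :=
  D.length_sim _

/-- The round and the transcript of a random input of the function family are independent. -/
lemma bind_round_tr (x : List Bool) (G : ℕ → Transcript → PMF Bool) :
    ((unif (D.inLen.eval x.length)).bind fun ρ => G (D.round x ρ) (D.tr x ρ)) =
      ((unif (D.indexLen.eval x.length)).map (index (Γ.coins x.length).length)).bind
        fun j => (D.dist x).bind (G j) := by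
  rw [inLen, Polynomial.eval_add, unif_add, PMF.bind_bind, PMF.bind_map]
  refine pmf_bind_congr fun u hu => ?_
  rw [mem_support_unif] at hu
  rw [PMF.bind_map, Function.comp_apply, dist, PMF.bind_map]
  refine pmf_bind_congr fun v _ => ?_
  simp only [Function.comp_apply, round, tr]
  rw [← hu, List.take_left, List.drop_left]

/-- A function value determines the round and the part of the transcript that is contained in it. -/
lemma fn_inj {x ρ ρ' : List Bool} (hρ : ρ.length ≤ D.inLen.eval x.length)
    (hρ' : ρ'.length ≤ D.inLen.eval x.length) (hj : D.round x ρ' < (Γ.coins x.length).length)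
    (h : D.fn x ρ' = D.fn x ρ) :
    D.round x ρ' = D.round x ρ ∧
      (D.tr x ρ').take (D.round x ρ) = (D.tr x ρ).take (D.round x ρ) ∧
      ((D.tr x ρ').getD (D.round x ρ) ([], [])).1 = ((D.tr x ρ).getD (D.round x ρ) ([], [])).1 ∧
      D.bit (D.round x ρ) x ρ' = D.bit (D.round x ρ) x ρ := by
  have hlen : ∀ ρ : List Bool, ρ.length ≤ D.inLen.eval x.length →
      (ρ.drop (D.indexLen.eval x.length)).length ≤ D.simCoins.eval x.length := by
    intro ρ h
    rw [inLen, Polynomial.eval_add] at h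
    rw [List.length_drop]
    omega
  obtain ⟨h1, h2, h3⟩ := serPartial_inj (D.ser_le x _ (hlen ρ' hρ') _ _)
    (D.ser_le x _ (hlen ρ hρ) _ _) h
  -- The prefixes have lengths `min round k`; since one of the rounds is below `k`, equal lengths
  -- force equal rounds.
  have h4 : D.round x ρ' = D.round x ρ := by
    have := congrArg List.length h1
    rw [List.length_take, List.length_take, D.length_sim, D.length_sim] at this
    simp only at this
    omega
  rw [h4] at h1 h2 h3
  exact ⟨h4, h1, h2, h3⟩

/-- The test `after`, restricted in the last round to accepting transcripts. -/
noncomputable def afterBit (O : Oracle PMF) (x : List Bool) (j : ℕ) (τ : Transcript) : PMF Bool :=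
  if (decide (j + 1 < (Γ.coins x.length).length) || Γ.verifier x τ) = true then D.after O x j τ
  else PMF.pure false

lemma before_length (O : Oracle PMF) (x : List Bool) {τ : Transcript}
    (h : τ.length = (Γ.coins x.length).length) :
    D.before O x (Γ.coins x.length).length τ = PMF.pure (Γ.verifier x τ) := by
  rw [before, List.drop_length, ← h, List.take_length, interact, PMF.pure_map]

lemma take_getD_append {τ : Transcript} {j : ℕ} (h : j < τ.length) :
    τ.take (j + 1) = τ.take j ++ [τ.getD j ([], [])] := by
  rw [List.take_add_one, List.getD_eq_getElem?_getD, List.getElem?_eq_getElem h]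
  rfl

/-- If the bit of `ρ` is `true`, the function value is precisely the cheating prover's query, and a
valid preimage extends the same partial transcript by precisely the prover's answer. If it is
`false`, the round is the last one and every valid preimage is a rejecting transcript, so the left
side vanishes. Invalid answers count as failures on the left. -/
lemma pr_inverter_le {A : Oracle PMF} {x ρ : List Bool}
    (hρ : ρ.length ≤ D.inLen.eval x.length) (J : ℕ → Prop) [DecidablePred J]
    (hJ : ∀ j, J j → j < (Γ.coins x.length).length) :
    pr ((A (x, D.fn x ρ)).bind fun ρ' =>
      if D.fn x (ρ'.take (D.inLen.eval x.length)) = D.fn x ρ ∧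
        J (D.round x (ρ'.take (D.inLen.eval x.length))) then
        D.before A x (D.round x (ρ'.take (D.inLen.eval x.length)) + 1)
          (D.tr x (ρ'.take (D.inLen.eval x.length)))
      else PMF.pure false) ≤
    pr (if J (D.round x ρ) then D.afterBit A x (D.round x ρ) (D.tr x ρ) else PMF.pure false) := by
  set m := D.inLen.eval x.length with hm
  have hinj : ∀ ρ' : List Bool, D.fn x (ρ'.take m) = D.fn x ρ → J (D.round x (ρ'.take m)) → _ :=
    fun ρ' h h' => D.fn_inj hρ (ρ' := ρ'.take m) (by rw [List.length_take]; omega) (hJ _ h') h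
  by_cases hgood : J (D.round x ρ) ∧ D.bit (D.round x ρ) x ρ = true
  · have hbit : (decide (D.round x ρ + 1 < (Γ.coins x.length).length) ||
        Γ.verifier x (D.tr x ρ)) = true := hgood.2
    rw [if_pos hgood.1, afterBit, if_pos hbit, after]
    set j := D.round x ρ with hj
    have hquery : D.query x ((D.tr x ρ).take j) ((D.tr x ρ).getD j ([], [])).1 = D.fn x ρ := by
      rw [fn, query, ← hj, hgood.2]
    rw [prover, hquery, PMF.bind_map]
    refine pr_bind_mono fun ρ' _ => ?_
    split_ifs with h
    · obtain ⟨h1, h2, h3, -⟩ := hinj ρ' h.1 h.2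
      have hjk := hJ _ hgood.1
      rw [Function.comp_apply, h1, before, take_getD_append (by rw [D.length_tr]; exact hjk), h2,
        ← h3, msg, List.length_take, D.length_tr, min_eq_left hjk.le]
    · rw [pr_pure]
      exact pr_nonneg _
  · refine le_trans (le_of_eq ?_) (pr_nonneg _)
    have : ((A (x, D.fn x ρ)).bind fun ρ' =>
        if D.fn x (ρ'.take m) = D.fn x ρ ∧ J (D.round x (ρ'.take m)) then
          D.before A x (D.round x (ρ'.take m) + 1) (D.tr x (ρ'.take m))
        else PMF.pure false) = (A (x, D.fn x ρ)).bind fun _ => PMF.pure false := by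
      refine pmf_bind_congr fun ρ' _ => ?_
      split_ifs with h
      · obtain ⟨h1, h2, h3, h4⟩ := hinj ρ' h.1 h.2
        have hJρ : J (D.round x ρ) := h1 ▸ h.2
        have hb : D.bit (D.round x ρ) x (ρ'.take m) = false := by
          rw [h4]
          simpa [hJρ] using hgood
        rw [bit, Bool.or_eq_false_iff, decide_eq_false_iff_not] at hb
        have := hJ _ hJρ
        rw [h1, show D.round x ρ + 1 = (Γ.coins x.length).length by omega,
          D.before_length A x (D.length_tr _ _), hb.2]
      · rfl
    rw [this, PMF.bind_const, pr_pure]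
    rfl

/-- The total loss, over all rounds, from replacing the simulated messages by the messages of the
cheating prover. -/
lemma sum_gap_le {A : Oracle PMF} {x : List Bool} {t : ℕ} {δ : ℝ}
    (hk : 1 ≤ (Γ.coins x.length).length) (ht : 2 * (Γ.coins x.length).length ≤ t + 1)
    (hA : DistInverts A D.fn x (D.inLen.eval x.length) δ) :
    ∑ j ∈ Finset.range (Γ.coins x.length).length,
      (pr ((D.dist x).bind (D.before A x (j + 1))) - pr ((D.dist x).bind (D.afterBit A x j))) ≤
      t * δ := by
  classical
  set k := (Γ.coins x.length).length with hkdef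
  -- Only rounds with a nonnegative gap are tested: rounds with a negative gap may be dropped from
  -- an upper bound, but could hide losses in the average over the random round.
  let J : ℕ → Prop := fun j => j < k ∧
    pr ((D.dist x).bind (D.afterBit A x j)) ≤ pr ((D.dist x).bind (D.before A x (j + 1)))
  let G : ℕ → Transcript → PMF Bool := fun j τ =>
    if J j then D.before A x (j + 1) τ else PMF.pure false
  let H : ℕ → Transcript → PMF Bool := fun j τ =>
    if J j then D.afterBit A x j τ else PMF.pure false
  have hG : ∀ j, pr ((D.dist x).bind (G j)) =
      if J j then pr ((D.dist x).bind (D.before A x (j + 1))) else 0 := by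
    intro j
    by_cases h : J j
    · simp only [G, h, if_true]
    · simp only [G, h, if_false, PMF.bind_const, pr_pure, Bool.false_eq_true]
  have hH : ∀ j, pr ((D.dist x).bind (H j)) =
      if J j then pr ((D.dist x).bind (D.afterBit A x j)) else 0 := by
    intro j
    by_cases h : J j
    · simp only [H, h, if_true]
    · simp only [H, h, if_false, PMF.bind_const, pr_pure, Bool.false_eq_true]
  set m := D.inLen.eval x.length with hm
  -- The test to which statistical distance is applied: check the claimed preimage, then let the
  -- cheating prover continue after the message that it contains.
  let g : List Bool × List Bool → PMF Bool := fun a =>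
    if D.fn x (a.1.take m) = a.2 ∧ J (D.round x (a.1.take m)) then
      D.before A x (D.round x (a.1.take m) + 1) (D.tr x (a.1.take m))
    else PMF.pure false
  have h1 := (pr_bind_le_statDist _ _ g).trans (add_le_add le_rfl hA)
  have h2 : ((unif m).map fun ρ => (ρ, D.fn x ρ)).bind g =
      (unif m).bind fun ρ => G (D.round x ρ) (D.tr x ρ) := by
    rw [PMF.bind_map]
    refine pmf_bind_congr fun ρ hρ => ?_
    rw [mem_support_unif] at hρ
    simp only [Function.comp_apply, g, G]
    rw [List.take_of_length_le hρ.le]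
    simp
  have h3 : pr (((unif m).bind fun ρ => (A (x, D.fn x ρ)).map fun ρ' => (ρ', D.fn x ρ)).bind g) ≤
      pr ((unif m).bind fun ρ => H (D.round x ρ) (D.tr x ρ)) := by
    rw [PMF.bind_bind]
    refine pr_bind_mono fun ρ hρ => ?_
    rw [mem_support_unif] at hρ
    rw [PMF.bind_map]
    exact D.pr_inverter_le hρ.le J fun j hj => hj.1
  rw [h2] at h1
  have h4 := h1.trans (add_le_add_left h3 δ)
  rw [D.bind_round_tr, D.bind_round_tr] at h4
  have h5 := sum_le_of_weights (k := k) (t := t) _ _ _ (by omega)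
    (fun j hj => index_prob (D.rounds_le x) hk ht hj) (fun j => ?_) h4
  · refine (Finset.sum_le_sum fun j hj => ?_).trans h5
    rw [hG, hH]
    by_cases h : J j
    · simp [h]
    · rw [if_neg h, if_neg h]
      simp only [J, Finset.mem_range.1 hj, true_and, not_le] at h
      linarith
  · rw [hG, hH]
    by_cases h : J j
    · rw [if_pos h, if_pos h]
      exact h.2
    · rw [if_neg h, if_neg h]

/-- In an interaction with a prover, the next random string of the verifier is uniform. -/
lemma view_bind_before (O : Oracle PMF) (P : Strategy) (x : List Bool) {j : ℕ}
    (hj : j < (Γ.coins x.length).length) :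
    (Γ.view P x).bind (D.before O x j) = (Γ.view P x).bind (D.after O x j) := by
  have hsplit : Γ.view P x = (interact P ((Γ.coins x.length).take j) []).bind
      (interact P ((Γ.coins x.length).drop j)) := by
    rw [Protocol.view, ← interact_append, List.take_append_drop]
  rw [hsplit, PMF.bind_bind, PMF.bind_bind]
  refine pmf_bind_congr fun τ hτ => ?_
  have hlen : τ.length = j := by
    obtain ⟨τ₁, rfl, h⟩ := mem_support_interact hτ
    have := congrArg List.length h
    rw [List.length_map, List.length_take, min_eq_left hj.le] at this
    simpa using this
  -- The test discards everything after round `j` and samples it anew, so the original continuation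
  -- integrates out.
  have h1 : (interact P ((Γ.coins x.length).drop j) τ).bind (D.before O x j) =
      (interact (D.prover O x) ((Γ.coins x.length).drop j) τ).map (Γ.verifier x) := by
    rw [← PMF.bind_const (interact P ((Γ.coins x.length).drop j) τ) (PMF.map _ _)]
    refine pmf_bind_congr fun τ' hτ' => ?_
    obtain ⟨τ₁, rfl, -⟩ := mem_support_interact hτ'
    rw [before, ← hlen, List.take_left]
  rw [h1, List.drop_eq_getElem_cons hj, interact, interact, PMF.map_bind, PMF.bind_bind]
  refine pmf_bind_congr fun r _ => ?_
  rw [PMF.bind_bind, ← PMF.bind_const (P τ r) (PMF.map _ _)]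
  refine pmf_bind_congr fun π _ => ?_
  rw [← PMF.bind_const (interact P ((Γ.coins x.length).drop (j + 1)) (τ ++ [(r, π)])) (PMF.map _ _)]
  refine pmf_bind_congr fun τ' hτ' => ?_
  obtain ⟨τ₁, rfl, -⟩ := mem_support_interact hτ'
  have e1 : (τ ++ [(r, π)] ++ τ₁).take j = τ := by
    rw [List.append_assoc, ← hlen, List.take_left]
  have e2 : ((τ ++ [(r, π)] ++ τ₁).getD j ([], [])).1 = r := by
    rw [List.append_assoc, ← hlen, List.getD_eq_getElem?_getD]
    simp
  rw [after, e1, e2, PMF.map_bind]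

end Simulator

end PublicCoinZK

namespace PublicCoinZK

/-! ### The hybrid argument -/

/-- For each `n` take a worst advice string. Non-uniformity thus yields one threshold for all
hybrids, although their number grows with `n`. -/
lemma eventually_forall_advice {Φ : ℕ → List Bool → Prop} (b : Polynomial ℕ)
    (h : ∀ z : ℕ → List Bool, (∃ b : Polynomial ℕ, ∀ n, (z n).length ≤ b.eval n) →
      ∀ᶠ n in Filter.atTop, Φ n (z n)) :
    ∀ᶠ n in Filter.atTop, ∀ z : List Bool, z.length ≤ b.eval n → Φ n z := by
  classical
  have hex : ∀ n, ∃ z : List Bool, z.length ≤ b.eval n ∧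
      (Φ n z → ∀ z' : List Bool, z'.length ≤ b.eval n → Φ n z') := by
    intro n
    by_cases hn : ∀ z' : List Bool, z'.length ≤ b.eval n → Φ n z'
    · exact ⟨[], by simp, fun _ => hn⟩
    · push Not at hn
      obtain ⟨z, hz, hz'⟩ := hn
      exact ⟨z, hz, fun hc => absurd hc hz'⟩
  choose z hz hz' using hex
  filter_upwards [h z ⟨b, hz⟩] with n hn
  exact hz' n hn

/-- Each round before the last costs its gap and two comparisons, the very first of which is charged
`ε₀`. The last costs its gap and a single `ε`, because `v k - u (k - 1) ≤ eV ≤ eS + ε = a k - b (k -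
1) + ε`. For `k = 1` only this `ε` occurs, and `hε` charges it to `ε₀`. -/
lemma hybrid_chain {k : ℕ} (hk : 1 ≤ k) {a b c u v : ℕ → ℝ} {ε ε₀ eS eV : ℝ}
    (hvu : ∀ j < k, v j = u j) (ha : ∀ j ≤ k, |a j - v j| ≤ ε) (hc : ∀ j < k, |c j - u j| ≤ ε)
    (hc₀ : |c 0 - u 0| ≤ ε₀) (hb : ∀ j, j + 1 < k → b j = c j) (hS : a k = b (k - 1) + eS)
    (hV : v k ≤ u (k - 1) + eV) (he : |eS - eV| ≤ ε) (hε : k = 1 → ε ≤ ε₀) :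
    v k - ∑ j ∈ Finset.range k, (a (j + 1) - b j) - ε₀ - (2 * k - 2) * ε ≤ v 0 := by
  have key : ∀ j, j + 1 < k → u (j + 1) - ∑ i ∈ Finset.range (j + 1), (a (i + 1) - b i) - ε₀ -
      (2 * j + 1) * ε ≤ u 0 := by
    intro j
    induction j with
    | zero =>
      intro hj
      have h1 := abs_le.1 (ha 1 hj.le)
      have h2 := abs_le.1 hc₀
      have h3 := hb 0 hj
      have h4 := hvu 1 hj
      simp only [zero_add, Finset.range_one, Finset.sum_singleton, Nat.cast_zero]
      linarith [h1.1, h1.2, h2.1, h2.2]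
    | succ j ih =>
      intro hj
      have h0 := ih (by omega)
      have h1 := abs_le.1 (ha (j + 1 + 1) hj.le)
      have h2 := abs_le.1 (hc (j + 1) (by omega))
      have h3 := hb (j + 1) hj
      have h4 := hvu (j + 1 + 1) hj
      rw [Finset.sum_range_succ]
      push_cast
      linarith [h1.1, h1.2, h2.1, h2.2]
  obtain ⟨K, rfl⟩ : ∃ K, k = K + 1 := ⟨k - 1, by omega⟩
  rw [Nat.add_sub_cancel] at hS hV
  have h0 := hvu 0 (by omega)
  have h1 := abs_le.1 he
  rw [Finset.sum_range_succ]
  cases K with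
  | zero =>
    have := hε rfl
    simp only [Finset.range_zero, Finset.sum_empty, zero_add, Nat.cast_one] at *
    linarith [h1.1, h1.2]
  | succ K =>
    have h2 := key K (by omega)
    push_cast
    linarith [h1.1, h1.2]

lemma pr_map_not (p : PMF Bool) : pr (p.map not) = 1 - pr p := by
  have h := pmf_tsum_toReal p
  rw [tsum_bool] at h
  have h' : (p.map not) true = p false := by
    rw [PMF.map_apply, tsum_bool]
    simp
  rw [pr, h', pr]
  linarith

namespace Simulator

variable {Γ : Protocol} (D : Simulator Γ)

/-- The hybrid tests are indistinguishable, uniformly in their parameters. -/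
lemma eventually_hybrid {Rel : List Bool → List Bool → Prop} {ε : ℕ → ℝ}
    {Sim : List Bool → PMF Transcript}
    (hSim : ∀ x : List Bool, (Sim x).map (normalize (Γ.coins x.length)) = D.dist x)
    (hZK : ∀ T : List Bool × List Bool × Transcript → PMF Bool, PPT T →
      ∀ z : ℕ → List Bool, (∃ b : Polynomial ℕ, ∀ n, (z n).length ≤ b.eval n) →
      ∀ᶠ n in Filter.atTop, ∀ x w : List Bool, x.length = n → Rel x w →
        |(((Sim x).bind fun τ => T (z n, x, τ)) true).toReal -
          (((Γ.view (Γ.prover x w) x).bind fun τ => T (z n, x, τ)) true).toReal| ≤ ε n)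
    {A : List Bool × List Bool → PMF (List Bool)} (hA : PPT A) :
    ∀ᶠ n in Filter.atTop, ∀ x w : List Bool, x.length = n → Rel x w →
      ∀ (flag flag' : Bool) (j : ℕ), j ≤ (Γ.coins n).length →
        |pr ((D.dist x).bind (D.hybrid A flag flag' j x)) -
          pr ((Γ.view (Γ.prover x w) x).bind (D.hybrid A flag flag' j x))| ≤ ε n := by
  let T : List Bool × List Bool × Transcript → PMF Bool := fun a =>
    D.hybrid A (a.1.getD 0 false) (a.1.getD 1 false) (a.1.length - 2) a.2.1
      (normalize (Γ.coins a.2.1.length) a.2.2)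
  filter_upwards [eventually_forall_advice (Φ := fun n z => ∀ x w : List Bool, x.length = n →
    Rel x w → |pr ((Sim x).bind fun τ => T (z, x, τ)) -
      pr ((Γ.view (Γ.prover x w) x).bind fun τ => T (z, x, τ))| ≤ ε n) (D.indexLen + 2)
    fun z hz => hZK T (D.ppt_hybrid hA) z hz] with n hn x w hx hw flag flag' j hj
  have hr := D.rounds_le x
  rw [hx] at hr
  have h := hn (flag :: flag' :: List.replicate j true)
    (by simp only [List.length_cons, List.length_replicate, Polynomial.eval_add,
          Polynomial.eval_ofNat]; omega) x w hx hw
  simp only [T, List.getD_cons_zero, List.getD_cons_succ, List.length_cons, List.length_replicate] at h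
  rw [← hSim x, ← view_map_normalize Γ (Γ.prover x w) x, PMF.bind_map, PMF.bind_map]
  exact h

lemma before_zero (O : Oracle PMF) (x : List Bool) : D.before O x 0 = fun _ => D.reduction O x := by
  funext τ
  simp only [before, List.drop_zero, List.take_zero]
  rfl

lemma hybrid_false (O : Oracle PMF) (flag : Bool) (j : ℕ) (x : List Bool) :
    D.hybrid O flag false j x = if flag = true then D.after O x j else D.before O x j := by
  funext τ
  cases flag <;> exact PMF.map_id _

lemma hybrid_true_true (O : Oracle PMF) (j : ℕ) (x : List Bool) (τ : Transcript) :
    pr (D.hybrid O true true j x τ) =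
      if Γ.verifier x τ = true then 1 - pr (D.after O x j τ) else 0 := by
  rw [hybrid]
  simp only [if_true]
  by_cases h : Γ.verifier x τ = true
  · rw [if_pos h, ← pr_map_not]
    congr 2
    funext b
    simp [h]
  · rw [if_neg h, Bool.not_eq_true] at *
    simp only [h, Bool.false_and]
    rw [show (fun _ : Bool => false) = Function.const _ false from rfl, PMF.map_const, pr_pure]
    rfl

/-- If the prover moves first, then the first comparison is perfect. -/
lemma after_zero (O : Oracle PMF) {x : List Bool} {P : PMF Transcript}
    (hP : ∀ τ ∈ P.support, (τ.getD 0 ([], [])).1 = []) :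
    P.bind (D.after O x 0) = D.after O x 0 [] := by
  rw [← PMF.bind_const P (D.after O x 0 [])]
  refine pmf_bind_congr fun τ hτ => ?_
  rw [after, after, hP τ hτ]
  simp

lemma reduction_ge {A : Oracle PMF} {x w : List Bool} {t : ℕ} {δ εc εz : ℝ} (ht : 2 ≤ t)
    (hmsg : t = 2 * (Γ.coins x.length).length ∨
      (t + 1 = 2 * (Γ.coins x.length).length ∧ (Γ.coins x.length).head? = some 0))
    (hcomplete : 1 - εc ≤ Γ.acceptProb (Γ.prover x w) x)
    (hhyb : ∀ (flag flag' : Bool) (j : ℕ), j ≤ (Γ.coins x.length).length →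
      |pr ((D.dist x).bind (D.hybrid A flag flag' j x)) -
        pr ((Γ.view (Γ.prover x w) x).bind (D.hybrid A flag flag' j x))| ≤ εz)
    (hA : DistInverts A D.fn x (D.inLen.eval x.length) δ) :
    1 - εc - ((t : ℝ) - 1) * εz - t * δ ≤ pr (D.reduction A x) := by
  set k := (Γ.coins x.length).length with hk
  have hk1 : 1 ≤ k := by omega
  set V := Γ.view (Γ.prover x w) x with hV
  have hVsupp : ∀ τ ∈ V.support, τ.map (fun a => a.1.length) = Γ.coins x.length := by
    intro τ hτ
    obtain ⟨τ₁, rfl, h⟩ := mem_support_interact hτ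
    exact h
  have hSlen : ∀ τ ∈ (D.dist x).support, τ.length = k := by
    intro τ hτ
    rw [dist, PMF.mem_support_map_iff] at hτ
    obtain ⟨ρ, -, rfl⟩ := hτ
    exact D.length_sim _
  have hVlen : ∀ τ ∈ V.support, τ.length = k := by
    intro τ hτ
    rw [hk, ← hVsupp τ hτ, List.length_map]
  have hbefore : ∀ j ≤ k,
      |pr ((D.dist x).bind (D.before A x j)) - pr (V.bind (D.before A x j))| ≤ εz := by
    intro j hj
    have := hhyb false false j hj
    rwa [hybrid_false] at this
  have hafter : ∀ j < k,
      |pr ((D.dist x).bind (D.after A x j)) - pr (V.bind (D.after A x j))| ≤ εz := by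
    intro j hj
    have := hhyb true false j hj.le
    rwa [hybrid_false] at this
  -- An equality for the simulator, since `afterBit` already counts accepting transcripts only; for
  -- the honest view, where `after` is not restricted in this way, the analogue is an inequality.
  have hS : pr ((D.dist x).bind (D.before A x k)) =
      pr ((D.dist x).bind (D.afterBit A x (k - 1))) +
        pr ((D.dist x).bind (D.hybrid A true true (k - 1) x)) := by
    refine pr_bind_add fun τ hτ => ?_
    rw [D.before_length A x (hSlen τ hτ), hybrid_true_true, pr_pure, afterBit,
      show decide (k - 1 + 1 < k) = false by simp; omega, Bool.false_or]
    split_ifs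
    · ring
    · rw [pr_pure]; simp
  have hVk : pr (V.bind (D.before A x k)) ≤ pr (V.bind (D.after A x (k - 1))) +
      pr (V.bind (D.hybrid A true true (k - 1) x)) := by
    refine pr_bind_le_add fun τ hτ => ?_
    rw [D.before_length A x (hVlen τ hτ), hybrid_true_true, pr_pure]
    split_ifs
    · linarith
    · linarith [pr_nonneg (D.after A x (k - 1) τ)]
  have hacc : pr (V.bind (D.before A x k)) = Γ.acceptProb (Γ.prover x w) x := by
    rw [pmf_bind_congr fun τ hτ => D.before_length A x (hVlen τ hτ)]
    rfl
  have hchain : ∀ ε₀, |pr ((D.dist x).bind (D.after A x 0)) - pr (V.bind (D.after A x 0))| ≤ ε₀ →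
      (k = 1 → εz ≤ ε₀) → _ := fun ε₀ h0 h1 =>
    hybrid_chain hk1 (ε₀ := ε₀) (u := fun j => pr (V.bind (D.after A x j)))
      (v := fun j => pr (V.bind (D.before A x j)))
      (c := fun j => pr ((D.dist x).bind (D.after A x j)))
      (b := fun j => pr ((D.dist x).bind (D.afterBit A x j)))
      (a := fun j => pr ((D.dist x).bind (D.before A x j)))
      (fun j hj => by rw [D.view_bind_before A _ x hj]) hbefore hafter h0
      (fun j hj => by
        have : D.afterBit A x j = D.after A x j := by
          funext τ
          rw [afterBit, decide_eq_true hj]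
          rfl
        rw [this]) hS hVk (hhyb true true (k - 1) (by omega)) h1
  have hsum := D.sum_gap_le (t := t) hk1 (by omega) hA
  have hzero : pr (V.bind (D.before A x 0)) = pr (D.reduction A x) := by
    rw [before_zero, PMF.bind_const]
  rcases hmsg with h | ⟨h, hhead⟩
  -- The verifier moves first: `ε₀ = εz` gives `2 * k - 1 = t - 1` comparisons.
  · have h1 := hchain εz (hafter 0 (by omega)) fun _ => le_rfl
    simp only [hacc, hzero] at h1
    rw [h] at hsum ⊢
    push_cast at hsum ⊢
    linarith
  · have h0 : (D.dist x).bind (D.after A x 0) = V.bind (D.after A x 0) := by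
      rw [D.after_zero A, D.after_zero A]
      · intro τ hτ
        have h2 := hVsupp τ hτ
        cases τ with
        | nil => rfl
        | cons a τ =>
          rw [← h2] at hhead
          simpa using hhead
      · intro τ hτ
        rw [dist, PMF.mem_support_map_iff] at hτ
        obtain ⟨ρ, -, rfl⟩ := hτ
        exact D.first_sim _ hhead
    -- The prover moves first: the first random string is empty on both sides, so `ε₀ = 0` and `2 *
    -- k - 2 = t - 1` comparisons remain. The case `k = 1` would mean `t = 1`, against `2 ≤ t`.
    have h1 := hchain 0 (by rw [h0, sub_self, abs_zero]) fun hk => by omega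
    simp only [hacc, hzero] at h1
    have h2 : (t : ℝ) = 2 * k - 1 := by
      rw [eq_sub_iff_add_eq]
      exact_mod_cast h
    rw [show ((t : ℝ) - 1) * εz = (2 * k - 2) * εz by rw [h2]; ring]
    linarith

end Simulator

end PublicCoinZK

/-! ### Conclusion -/

theorem lemma3p2 (εc εs εz : ℕ → unitInterval) (t : ℕ → ℕ) (ht : ∀ n, 2 ≤ t n)
    (L : Language Bool) (Rel : List Bool → List Bool → Prop) (hNP : IsNPRelation L Rel)
    (Γ : Protocol) (hmsg : Γ.HasMessages t)
    (hZK : Γ.IsZKProof L Rel (fun n => εc n) (fun n => εs n) (fun n => εz n) ∨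
      Γ.IsZKArgument L Rel (fun n => εc n) (fun n => εs n) (fun n => εz n)) :
    ∃ (R : Oracle PMF → List Bool → PMF Bool) (f : List Bool → List Bool → List Bool)
      (m₁ m₂ : Polynomial ℕ),
      OraclePolyTime R ∧ IsPolyTimeFamily f m₁ m₂ ∧
      ∀ (A : List Bool × List Bool → PMF (List Bool)), PPT A → ∀ p : Polynomial ℝ,
        ∀ᶠ n : ℕ in Filter.atTop, ∀ x : List Bool, x.length = n →
          (x ∈ L → DistInverts A f x (m₁.eval n) (1 / p.eval (n : ℝ)) →
            1 - (εc n : ℝ) - ((t n : ℝ) - 1) * (εz n : ℝ) - (t n : ℝ) / p.eval (n : ℝ) ≤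
              (R A x true).toReal) ∧
          (x ∉ L → (R A x true).toReal ≤ (εs n : ℝ)) := by
  have hall : Γ.EfficientVerifier ∧ Γ.Complete Rel (fun n => εc n) ∧
      Γ.ZeroKnowledge Rel (fun n => εz n) ∧
      (Γ.Sound L (fun n => εs n) ∨ Γ.ComputationallySound L (fun n => εs n)) := by
    rcases hZK with ⟨h1, -, h2, h3, h4⟩ | ⟨h1, -, -, h2, h3, h4⟩
    · exact ⟨h1, h2, h4, .inl h3⟩
    · exact ⟨h1, h2, h4, .inr h3⟩
  obtain ⟨hver, hcomplete, ⟨Sim, hSim, hzk⟩, hsound⟩ := hall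
  obtain ⟨D, hD⟩ := exists_simulator hver hSim
  refine ⟨D.reduction, D.fn, D.inLen, D.serLen, D.oraclePolyTime_reduction,
    D.isPolyTimeFamily_fn, fun A hA p => ?_⟩
  -- By definition the reduction accepts with the verifier's acceptance probability against the
  -- cheating prover, so soundness is the second claim.
  have hs : ∀ᶠ n in Filter.atTop, ∀ x : List Bool, x.length = n → x ∉ L →
      Γ.acceptProb (D.prover A x) x ≤ εs n := by
    rcases hsound with h | h
    · exact .of_forall fun n x hx hxL => hx ▸ h x hxL _
    · exact h (D.prover A) (D.ppt_prover hA) (D.exists_prover_bound A)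
  filter_upwards [hs, D.eventually_hybrid hD hzk hA] with n hn hn' x hx
  refine ⟨fun hxL hinv => ?_, fun hxL => hn x hx hxL⟩
  subst hx
  obtain ⟨w, hw⟩ := (hNP.2.2 x).1 hxL
  have h := D.reduction_ge (ht x.length) (hmsg x.length) (hcomplete x w hw)
    (hn' x w rfl hw) hinv
  rwa [mul_one_div] at h
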